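/- Let $K$ be an algebraically closed field and $A$ a finite-dimensional $K$-algebra; let $A\text{-Mod}$ be the category of finite-dimensional left $A$-modules. A module class is a class $\mathcal C$ of $A$-modules that is closed under isomorphisms and satisfies: $X\oplus Y\in\mathcal C$ if and only if $X,Y\in\mathcal C$. Write $\operatorname{add} M$ for the smallest module class containing $M$, and $\operatorname{gen} M$ for the class of all quotients of modules in $\operatorname{add} M$. A torsion pair in $A\text{-Mod}$ is a pair $(\mathcal T,\mathcal F)$ of module classes of finite-dimensional modules such that $\operatorname{Hom}_A(T,F)=0$ for all $T\in\mathcal T$, $F\in\mathcal F$, and such that every $X\in A\text{-Mod}$ fits into a short exact sequence $0\to X'\to X\to X''\to 0$ with $X'\in\mathcal T$, $X''\in\mathcal F$. A $\mathcal T$-envelope of $X$ is a map $\theta:X\to T$ with $T\in\mathcal T$ such that every map from $X$ to a module in $\mathcal T$ factors through $\theta$, and such that every $\alpha\in\operatorname{End}_A(T)$ with $\alpha\theta=\theta$ is invertible; $\mathcal T$-covers $T\to X$ are defined dually. $\mathcal T$ is functorially finite if every $X\in A\text{-Mod}$ has a $\mathcal T$-envelope and a $\mathcal T$-cover. A module $M\in\mathcal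 T$ is Ext-projective in $\mathcal T$ if $\operatorname{Ext}^1_A(M,Y)=0$ for all $Y\in\mathcal T$, and $\mathcal P(\mathcal T)$ denotes the direct sum of the indecomposable Ext-projective modules in $\mathcal T$, with one summand for each isomorphism class. Let $\operatorname{ann}\mathcal T=\{a\in A : aX=0\text{ for all }X\in\mathcal T\}$, a two-sided ideal of $A$; since $\operatorname{ann}\mathcal T$ annihilates $\mathcal P(\mathcal T)$, the latter is an $(A/\operatorname{ann}\mathcal T)$-module. A finite-dimensional module $T$ over a finite-dimensional algebra $B$ is tilting if $\operatorname{Ext}^1_B(T,T)=0$, the projective dimension of $T$ is at most $1$, and there is a short exact sequence $0\to {}_BB\to T^0\to T^1\to 0$ with $T^0,T^1\in\operatorname{add} T$. **Proposition.** Let $(\mathcal T,\mathcal F)$ be a torsion pair in $A\text{-Mod}$. Then the following conditions are equivalent: 1. $\mathcal T$ is functorially finite. 2. $\mathcal T=\operatorname{gen}\mathcal P(\mathcal T)$. 3. $\mathcal T=\operatorname{gen} X$ for some $X\in A\text{-Mod}$. 4. $\mathcal P(\mathcal T)$ is a tilting $(A/\operatorname{ann}\mathcal T)$-module. -/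

import Mathlib

open CategoryTheory CategoryTheory.Limits CategoryTheory.Abelian
open scoped DirectSum

universe u w

namespace TauTilting

section

variable {A : Type u} [Ring A]

/-- A class of left `A`-modules which is closed under isomorphisms and for which
`X, Y ∈ C` holds if and only if `X ⊕ Y ∈ C`. -/
structure IsModuleClass (C : ObjectProperty (ModuleCat.{u} A)) : Prop where
  of_iso : ∀ ⦃X Y : ModuleCat.{u} A⦄, (X ≅ Y) → C X → C Y
  biprod_iff : ∀ X Y : ModuleCat.{u} A, C (X ⊞ Y) ↔ C X ∧ C Y

/-- The finitely generated modules. When `A` is a finite-dimensional algebra over a field, these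
are the finite-dimensional modules, i.e. the objects of the category written `A-Mod`. -/
def FinDim (A : Type u) [Ring A] : ObjectProperty (ModuleCat.{u} A) :=
  fun X => Module.Finite A X

/-- A torsion pair `(𝒯, ℱ)` in the category of finite-dimensional `A`-modules. -/
structure IsTorsionPair (𝒯 ℱ : ObjectProperty (ModuleCat.{u} A)) : Prop where
  torsion_le : 𝒯 ≤ FinDim A
  torsionFree_le : ℱ ≤ FinDim A
  torsion_isModuleClass : IsModuleClass 𝒯
  torsionFree_isModuleClass : IsModuleClass ℱ
  hom_eq_zero : ∀ ⦃X Y : ModuleCat.{u} A⦄, 𝒯 X → ℱ Y → ∀ f : X ⟶ Y, f = 0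
  exists_shortExact : ∀ X : ModuleCat.{u} A, FinDim A X →
    ∃ S : ShortComplex (ModuleCat.{u} A),
      S.ShortExact ∧ Nonempty (S.X₂ ≅ X) ∧ 𝒯 S.X₁ ∧ ℱ S.X₃

/-- `add M`: the smallest module class containing `M`. -/
def add (M : ModuleCat.{u} A) : ObjectProperty (ModuleCat.{u} A) :=
  fun X => ∀ C : ObjectProperty (ModuleCat.{u} A), IsModuleClass C → C M → C X

/-- `gen M`: the class of quotients of modules in `add M`. It contains `M` itself, so that
`gen M` consists of finitely generated modules only if `M` is finitely generated. -/
def gen (M : ModuleCat.{u} A) : ObjectProperty (ModuleCat.{u} A) :=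
  fun X => ∃ (M₀ : ModuleCat.{u} A) (f : M₀ ⟶ X), add M M₀ ∧ Function.Surjective f

/-- Codomain minimal maps (also called left minimal). -/
def IsCodomainMinimal {X Y : ModuleCat.{u} A} (θ : X ⟶ Y) : Prop :=
  ∀ α : Y ⟶ Y, θ ≫ α = θ → IsIso α

/-- Domain minimal maps (also called right minimal). -/
def IsDomainMinimal {X Y : ModuleCat.{u} A} (θ : X ⟶ Y) : Prop :=
  ∀ β : X ⟶ X, β ≫ θ = θ → IsIso β

/-- `θ : X ⟶ Y` is a `C`-envelope: a codomain minimal map to a member of `C` through which every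
map from `X` to a member of `C` factors. -/
structure IsEnvelope (C : ObjectProperty (ModuleCat.{u} A)) {X Y : ModuleCat.{u} A}
    (θ : X ⟶ Y) : Prop where
  mem : C Y
  exists_factor : ∀ ⦃Z : ModuleCat.{u} A⦄, C Z → ∀ f : X ⟶ Z, ∃ g : Y ⟶ Z, θ ≫ g = f
  minimal : IsCodomainMinimal θ

/-- `θ : Y ⟶ X` is a `C`-cover: a domain minimal map from a member of `C` through which every
map from a member of `C` to `X` factors. -/
structure IsCover (C : ObjectProperty (ModuleCat.{u} A)) {X Y : ModuleCat.{u} A}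
    (θ : Y ⟶ X) : Prop where
  mem : C Y
  exists_factor : ∀ ⦃Z : ModuleCat.{u} A⦄, C Z → ∀ f : Z ⟶ X, ∃ g : Z ⟶ Y, g ≫ θ = f
  minimal : IsDomainMinimal θ

def IsCovariantlyFinite (C : ObjectProperty (ModuleCat.{u} A)) : Prop :=
  ∀ X : ModuleCat.{u} A, FinDim A X →
    ∃ (Y : ModuleCat.{u} A) (θ : X ⟶ Y), IsEnvelope C θ

def IsContravariantlyFinite (C : ObjectProperty (ModuleCat.{u} A)) : Prop :=
  ∀ X : ModuleCat.{u} A, FinDim A X →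
    ∃ (Y : ModuleCat.{u} A) (θ : Y ⟶ X), IsCover C θ

def IsFunctoriallyFinite (C : ObjectProperty (ModuleCat.{u} A)) : Prop :=
  IsCovariantlyFinite C ∧ IsContravariantlyFinite C

/-- `M` lies in `C` and `Ext¹(M, Y) = 0` for all `Y` in `C`. -/
def IsExtProjective (C : ObjectProperty (ModuleCat.{u} A)) (M : ModuleCat.{u} A) : Prop :=
  C M ∧ ∀ Y : ModuleCat.{u} A, C Y → Subsingleton (Ext M Y 1)

/-- The indecomposable Ext-projective modules in `𝒯` of the form `Aⁿ ⧸ N`. For a class `𝒯` of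
finitely generated modules closed under isomorphisms, every indecomposable Ext-projective
module in `𝒯` is isomorphic to one of these. -/
def IndecExtProj (𝒯 : ObjectProperty (ModuleCat.{u} A)) : Type u :=
  {c : FGModuleRepr A //
    Indecomposable (ModuleCat.of A c) ∧ IsExtProjective 𝒯 (ModuleCat.of A c)}

/-- Isomorphism of indecomposable Ext-projective modules. -/
instance indecExtProjSetoid (𝒯 : ObjectProperty (ModuleCat.{u} A)) :
    Setoid (IndecExtProj 𝒯) where
  r c d := Nonempty (ModuleCat.of A c.1 ≅ ModuleCat.of A d.1)
  iseqv :=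
    { refl := fun _ => ⟨Iso.refl _⟩
      symm := fun ⟨e⟩ => ⟨e.symm⟩
      trans := fun ⟨e⟩ ⟨e'⟩ => ⟨e.trans e'⟩ }

/-- `𝒫(𝒯)`: the direct sum of the indecomposable Ext-projective modules in `𝒯`, with one summand
chosen in each isomorphism class. -/
noncomputable def extProjSum (𝒯 : ObjectProperty (ModuleCat.{u} A)) : ModuleCat.{u} A :=
  ModuleCat.of A (⨁ i : _root_.Quotient (indecExtProjSetoid 𝒯), (i.out.1 : Type u))

/-- `ann 𝒯`: the elements of `A` that act as zero on all modules in `𝒯`. -/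
def ann (𝒯 : ObjectProperty (ModuleCat.{u} A)) : Ideal A where
  carrier := {a | ∀ X : ModuleCat.{u} A, 𝒯 X → ∀ x : X, a • x = 0}
  add_mem' ha hb X hX x := by rw [add_smul, ha X hX x, hb X hX x, add_zero]
  zero_mem' X _ x := zero_smul A x
  smul_mem' c a ha X hX x := by rw [smul_eq_mul, mul_smul, ha X hX x, smul_zero]

instance ann_isTwoSided (𝒯 : ObjectProperty (ModuleCat.{u} A)) : (ann 𝒯).IsTwoSided :=
  ⟨fun {a} b ha X hX x => by rw [mul_smul]; exact ha X hX (b • x)⟩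

theorem extProjSum_isTorsionBySet (𝒯 : ObjectProperty (ModuleCat.{u} A)) :
    Module.IsTorsionBySet A (extProjSum 𝒯) (ann 𝒯 : Set A) := by
  rintro x ⟨a, ha⟩
  refine DFinsupp.ext fun i => ?_
  exact ha (ModuleCat.of A (i.out.1 : Type u)) i.out.2.2.1 _

/-- `𝒫(𝒯)` regarded as a module over `A ⧸ ann 𝒯`. -/
noncomputable def extProjSumQuot (𝒯 : ObjectProperty (ModuleCat.{u} A)) :
    ModuleCat.{u} (A ⧸ ann 𝒯) :=
  letI : Module (A ⧸ ann 𝒯) (extProjSum 𝒯) := (extProjSum_isTorsionBySet 𝒯).module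
  ModuleCat.of (A ⧸ ann 𝒯) (extProjSum 𝒯)

/-- (Classical) tilting modules. -/
structure IsTilting (T : ModuleCat.{u} A) : Prop where
  finDim : FinDim A T
  ext_eq_zero : Subsingleton (Ext T T 1)
  projDim_le_one : HasProjectiveDimensionLE T 1
  /-- There is a short exact sequence `0 → A → T⁰ → T¹ → 0` with `T⁰` and `T¹` in `add T`. -/
  exists_shortExact : ∃ S : ShortComplex (ModuleCat.{u} A),
    S.ShortExact ∧ Nonempty (S.X₁ ≅ ModuleCat.of A A) ∧ add T S.X₂ ∧ add T S.X₃

end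

end TauTilting

/-! A torsion class consists of the finitely generated modules with no nonzero map to `ℱ`. It is
therefore closed under quotients and extensions, and torsion submodules give covers, so functorial
finiteness is only a question of envelopes.

The central object is the envelope `θ : A → T` of the regular module, with cokernel `T₁`. An element
of a module in `𝒯` is the image of `1` under a map from `A`, and this map factors through `θ`; hence
`T` generates `𝒯` and `ker θ = ann 𝒯`. Minimality of `θ` makes `T` Ext-projective, and `T₁` is then
Ext-projective because maps from `θ(A)` into `𝒯` extend to `T`. Conversely, for `M` Ext-projective,
a right approximation of `M` by powers of `T ⊕ T₁` is onto, and `Ext¹(T₁, -)` vanishes on its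
kernel. So `T` generates the kernel, which thus lies in `𝒯`, and the approximation splits. By
Krull–Schmidt there are only finitely many indecomposable Ext-projectives, so `𝒫(𝒯)` is
finite-dimensional and generates `𝒯`: this is 1 → 2. The sequence `A ⧸ ann 𝒯 → T → T₁` is the
tilting sequence for 1 → 4.

For 3 → 1, a left approximation of a free module by powers of `X` is pushed out along a presentation
and then shrunk to a minimal map. For 4 → 2, with a tilting sequence ending in `T⁰ → T¹`, the
vanishing of `Ext¹(T¹, X)` extends every map `A → X` over `T⁰`, so `T⁰` generates `𝒯`. -/

namespace TauTilting

/-! ### Vanishing of `Ext¹` as lifting and extension properties. -/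

section ExtOne

variable {R : Type u} [Ring R] {M Y X E F : Type u}
  [AddCommGroup M] [Module R M] [AddCommGroup Y] [Module R Y] [AddCommGroup X] [Module R X]
  [AddCommGroup E] [Module R E] [AddCommGroup F] [Module R F]

variable (R M Y) in
/-- `Ext¹(M, Y) = 0`. -/
abbrev ExtVanish : Prop := Subsingleton (Ext (ModuleCat.of R M) (ModuleCat.of R Y) 1)

/-- The short exact sequence of modules given by linear maps. -/
theorem shortExact_ofHom {i : X →ₗ[R] E} {p : E →ₗ[R] F} (hi : Function.Injective i)
    (hp : Function.Surjective p) (h : Function.Exact i p) :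
    (ModuleCat.shortComplexOfCompEqZero i p h.linearMap_comp_eq_zero).ShortExact :=
  ModuleCat.shortComplex_shortExact _ h hi hp

/-- Maps out of `M` lift along an extension with kernel `Y` if `Ext¹(M, Y) = 0`. -/
theorem ExtVanish.exists_lift (hext : ExtVanish R M Y) {i : Y →ₗ[R] E} {p : E →ₗ[R] F}
    (hi : Function.Injective i) (hp : Function.Surjective p) (h : Function.Exact i p)
    (f : M →ₗ[R] F) : ∃ g : M →ₗ[R] E, p ∘ₗ g = f := by
  have hS := shortExact_ofHom hi hp h
  obtain ⟨x, hx⟩ := Ext.covariant_sequence_exact₃ (ModuleCat.of R M) hS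
    (Ext.mk₀ (ModuleCat.ofHom f)) (zero_add 1) (Subsingleton.elim (α := Ext _ _ 1) _ _)
  obtain ⟨g, rfl⟩ := (Ext.mk₀_bijective _ _).surjective x
  rw [Ext.mk₀_comp_mk₀] at hx
  have := (Ext.mk₀_bijective _ _).injective hx
  exact ⟨g.hom, congrArg ModuleCat.Hom.hom this⟩

/-- Maps into `Y` extend along an extension with cokernel `M` if `Ext¹(M, Y) = 0`. -/
theorem ExtVanish.exists_extend (hext : ExtVanish R M Y) {i : X →ₗ[R] E} {p : E →ₗ[R] M}
    (hi : Function.Injective i) (hp : Function.Surjective p) (h : Function.Exact i p)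
    (f : X →ₗ[R] Y) : ∃ g : E →ₗ[R] Y, g ∘ₗ i = f := by
  have hS := shortExact_ofHom hi hp h
  obtain ⟨x, hx⟩ := Ext.contravariant_sequence_exact₁ hS (ModuleCat.of R Y)
    (Ext.mk₀ (ModuleCat.ofHom f)) (add_zero 1) (Subsingleton.elim (α := Ext _ _ 1) _ _)
  obtain ⟨g, rfl⟩ := (Ext.mk₀_bijective _ _).surjective x
  rw [Ext.mk₀_comp_mk₀] at hx
  have := (Ext.mk₀_bijective _ _).injective hx
  exact ⟨g.hom, congrArg ModuleCat.Hom.hom this⟩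

/-- If `Ext¹(M, E) = 0` and every map from `M` to `F` lifts to `E`, then `Ext¹(M, Y) = 0` for the
kernel `Y` of `E → F`. -/
theorem ExtVanish.of_kernel {i : Y →ₗ[R] E} {p : E →ₗ[R] F}
    (hi : Function.Injective i) (hp : Function.Surjective p) (h : Function.Exact i p)
    (hext : ExtVanish R M E)
    (hlift : ∀ f : M →ₗ[R] F, ∃ g : M →ₗ[R] E, p ∘ₗ g = f) : ExtVanish R M Y := by
  have hS := shortExact_ofHom hi hp h
  refine subsingleton_of_forall_eq 0 fun e => ?_
  obtain ⟨x, hx⟩ := Ext.covariant_sequence_exact₁ (ModuleCat.of R M) hS e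
    (Subsingleton.elim (α := Ext _ _ 1) _ _) (zero_add 1)
  obtain ⟨f, rfl⟩ := (Ext.mk₀_bijective _ _).surjective x
  obtain ⟨g, hg⟩ := hlift f.hom
  have hf : f = ModuleCat.ofHom g ≫ (ModuleCat.shortComplexOfCompEqZero i p
      h.linearMap_comp_eq_zero).g := ModuleCat.hom_ext hg.symm
  -- The class `e` is `f` times the class of the extension; as `f` factors through `p`, the product
  -- vanishes.
  rw [← hx, hf, ← Ext.mk₀_comp_mk₀, Ext.comp_assoc_of_second_deg_zero, hS.comp_extClass,
    Ext.comp_zero]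

/-- If `Ext¹(E, Y) = 0` and every map from `X ⊆ E` to `Y` extends to `E`, then `Ext¹(M, Y) = 0` for
the cokernel `M` of `X → E`. -/
theorem ExtVanish.of_cokernel {i : X →ₗ[R] E} {p : E →ₗ[R] M}
    (hi : Function.Injective i) (hp : Function.Surjective p) (h : Function.Exact i p)
    (hext : ExtVanish R E Y)
    (hextend : ∀ f : X →ₗ[R] Y, ∃ g : E →ₗ[R] Y, g ∘ₗ i = f) : ExtVanish R M Y := by
  have hS := shortExact_ofHom hi hp h
  refine subsingleton_of_forall_eq 0 fun e => ?_
  obtain ⟨x, hx⟩ := Ext.contravariant_sequence_exact₃ hS (ModuleCat.of R Y) e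
    (Subsingleton.elim (α := Ext _ _ 1) _ _) (add_zero 1)
  obtain ⟨f, rfl⟩ := (Ext.mk₀_bijective _ _).surjective x
  obtain ⟨g, hg⟩ := hextend f.hom
  have hf : f = (ModuleCat.shortComplexOfCompEqZero i p
      h.linearMap_comp_eq_zero).f ≫ ModuleCat.ofHom g := ModuleCat.hom_ext hg.symm
  rw [← hx, hf, ← Ext.mk₀_comp_mk₀, hS.extClass_comp_assoc]

variable (R M Y) in
/-- `Ext¹(M, Y) = 0` if maps out of `M` lift along all surjections with kernel `Y`. -/
theorem ExtVanish.of_lift (hlift : ∀ (E F : Type u) [AddCommGroup E] [Module R E] [AddCommGroup F]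
    [Module R F] (i : Y →ₗ[R] E) (p : E →ₗ[R] F), Function.Injective i → Function.Surjective p →
    Function.Exact i p → ∀ f : M →ₗ[R] F, ∃ g : M →ₗ[R] E, p ∘ₗ g = f) : ExtVanish R M Y := by
  -- One test extension suffices: an embedding of `Y` into an injective `J`, where `Ext¹(M, J) = 0`.
  let J := Injective.under (ModuleCat.of R Y)
  let i : Y →ₗ[R] J := (Injective.ι (ModuleCat.of R Y)).hom
  have hi : Function.Injective i := (ModuleCat.mono_iff_injective _).1 inferInstance
  have hp := (LinearMap.range i).mkQ_surjective
  have h : Function.Exact i (LinearMap.range i).mkQ := LinearMap.exact_map_mkQ_range i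
  exact ExtVanish.of_kernel hi hp h (Ext.subsingleton_of_injective _ J 0)
    (hlift _ _ i _ hi hp h)

end ExtOne


/-! ### Module classes, `add`, `gen` and closure properties of torsion classes. -/

section Classes

variable {A : Type u} [Ring A]

/-- `X` is a direct summand of `Mⁿ` for some `n`. -/
def IsSummandOfPower (A : Type u) [Ring A] (M X : Type u) [AddCommGroup M] [Module A M]
    [AddCommGroup X] [Module A X] : Prop :=
  ∃ (n : ℕ) (s : X →ₗ[A] (Fin n → M)) (r : (Fin n → M) →ₗ[A] X), r ∘ₗ s = LinearMap.id

section

variable {M X Y : Type u} [AddCommGroup M] [Module A M] [AddCommGroup X] [Module A X]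
  [AddCommGroup Y] [Module A Y]

/-- A module with a retraction is the product of the retract and the kernel. -/
noncomputable def prodKerEquiv (s : X →ₗ[A] Y) (r : Y →ₗ[A] X) (h : r ∘ₗ s = LinearMap.id) :
    (X × LinearMap.ker r) ≃ₗ[A] Y := by
  have hrs : ∀ x, r (s x) = x := fun x => LinearMap.congr_fun h x
  refine LinearEquiv.ofBijective (s.coprod (LinearMap.ker r).subtype) ⟨?_, fun y => ?_⟩
  · rw [injective_iff_map_eq_zero]
    rintro ⟨x, k, hk⟩ h0
    simp only [LinearMap.coprod_apply, Submodule.subtype_apply] at h0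
    have hx : x = 0 := by
      have := congrArg r h0
      rwa [map_add, hrs, LinearMap.mem_ker.1 hk, add_zero, map_zero] at this
    subst hx
    simpa using h0
  · exact ⟨(r y, ⟨y - s (r y), by simp [hrs]⟩), by simp⟩

theorem IsSummandOfPower.of_retract (h : IsSummandOfPower A M Y) {s : X →ₗ[A] Y} {r : Y →ₗ[A] X}
    (hrs : r ∘ₗ s = LinearMap.id) : IsSummandOfPower A M X := by
  obtain ⟨n, s', r', h'⟩ := h
  refine ⟨n, s' ∘ₗ s, r ∘ₗ r', ?_⟩
  rw [LinearMap.comp_assoc, ← LinearMap.comp_assoc s, h', LinearMap.id_comp, hrs]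

theorem IsSummandOfPower.of_equiv (h : IsSummandOfPower A M Y) (e : X ≃ₗ[A] Y) :
    IsSummandOfPower A M X :=
  h.of_retract (s := e.toLinearMap) (r := e.symm.toLinearMap) (by ext; simp)

theorem IsSummandOfPower.prod (hX : IsSummandOfPower A M X) (hY : IsSummandOfPower A M Y) :
    IsSummandOfPower A M (X × Y) := by
  obtain ⟨n, s, r, h⟩ := hX
  obtain ⟨m, s', r', h'⟩ := hY
  let e : (Fin (n + m) → M) ≃ₗ[A] (Fin n → M) × (Fin m → M) :=
    (LinearEquiv.funCongrLeft A M finSumFinEquiv).trans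
      (LinearEquiv.sumArrowLequivProdArrow _ _ A M)
  refine ⟨n + m, e.symm.toLinearMap ∘ₗ s.prodMap s', r.prodMap r' ∘ₗ e.toLinearMap, ?_⟩
  apply LinearMap.ext
  rintro ⟨x, y⟩
  have hx := LinearMap.congr_fun h x
  have hy := LinearMap.congr_fun h' y
  simp only [LinearMap.comp_apply, LinearMap.id_apply] at hx hy
  simp [hx, hy]

variable (A M) in
theorem IsSummandOfPower.pi (n : ℕ) : IsSummandOfPower A M (Fin n → M) :=
  ⟨n, LinearMap.id, LinearMap.id, rfl⟩

variable (A M) in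
theorem IsSummandOfPower.refl : IsSummandOfPower A M M :=
  (IsSummandOfPower.pi A M 1).of_equiv (LinearEquiv.funUnique (Fin 1) A M).symm

theorem IsSummandOfPower.of_subsingleton [Subsingleton X] : IsSummandOfPower A M X :=
  ⟨0, 0, 0, LinearMap.ext fun _ => Subsingleton.elim _ _⟩

end

namespace IsModuleClass

variable {C : ObjectProperty (ModuleCat.{u} A)} (hC : IsModuleClass C)
  {X Y : Type u} [AddCommGroup X] [Module A X] [AddCommGroup Y] [Module A Y]

include hC

theorem of_equiv (h : C (ModuleCat.of A X)) (e : X ≃ₗ[A] Y) : C (ModuleCat.of A Y) :=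
  hC.of_iso e.toModuleIso h

theorem prod_iff : C (ModuleCat.of A (X × Y)) ↔ C (ModuleCat.of A X) ∧ C (ModuleCat.of A Y) := by
  rw [← hC.biprod_iff]
  let e := ModuleCat.biprodIsoProd (ModuleCat.of A X) (ModuleCat.of A Y)
  exact ⟨hC.of_iso e.symm, hC.of_iso e⟩

theorem of_retract (h : C (ModuleCat.of A Y)) {s : X →ₗ[A] Y} {r : Y →ₗ[A] X}
    (hrs : r ∘ₗ s = LinearMap.id) : C (ModuleCat.of A X) :=
  (hC.prod_iff.1 (hC.of_equiv h (prodKerEquiv s r hrs).symm)).1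

theorem of_subsingleton [Subsingleton Y] (h : C (ModuleCat.of A X)) : C (ModuleCat.of A Y) :=
  hC.of_retract h (s := 0) (r := 0) (LinearMap.ext fun _ => Subsingleton.elim _ _)

theorem pi (h : C (ModuleCat.of A X)) (n : ℕ) : C (ModuleCat.of A (Fin n → X)) := by
  induction n with
  | zero => exact hC.of_subsingleton h
  | succ n ih =>
    exact hC.of_equiv (hC.prod_iff.2 ⟨h, ih⟩) (Fin.consLinearEquiv A (fun _ : Fin (n + 1) => X))

end IsModuleClass

/-- Summands of powers of `M` form a module class containing `M`, and every module class is closed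
under finite powers and retracts. -/
theorem add_iff {M X : ModuleCat.{u} A} : add M X ↔ IsSummandOfPower A M X := by
  constructor
  · intro h
    refine h (fun Z => IsSummandOfPower A M Z) ⟨fun X Y e hX => hX.of_equiv e.symm.toLinearEquiv,
      fun X Y => ?_⟩ (IsSummandOfPower.refl A M)
    constructor
    · intro h
      have h' : IsSummandOfPower A M (X × Y) :=
        h.of_equiv (ModuleCat.biprodIsoProd X Y).symm.toLinearEquiv
      exact ⟨h'.of_retract (LinearMap.fst_comp_inl A X Y),
        h'.of_retract (LinearMap.snd_comp_inr A X Y)⟩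
    · rintro ⟨hX, hY⟩
      exact (hX.prod hY).of_equiv (ModuleCat.biprodIsoProd X Y).toLinearEquiv
  · rintro ⟨n, s, r, h⟩ C hC hM
    exact hC.of_retract (hC.pi hM n) h

theorem gen_iff {M X : ModuleCat.{u} A} :
    gen M X ↔ ∃ (n : ℕ) (f : (Fin n → M) →ₗ[A] X), Function.Surjective f := by
  constructor
  · rintro ⟨M₀, f, h, hf⟩
    obtain ⟨n, s, r, h⟩ := add_iff.1 h
    exact ⟨n, f.hom ∘ₗ r, hf.comp fun x => ⟨s x, LinearMap.congr_fun h x⟩⟩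
  · rintro ⟨n, f, hf⟩
    exact ⟨ModuleCat.of A (Fin n → M), ModuleCat.ofHom f, add_iff.2 (.pi A M n), hf⟩

theorem gen_self (M : ModuleCat.{u} A) : gen M M :=
  ⟨M, 𝟙 M, fun _ _ h => h, Function.surjective_id⟩

namespace IsTorsionPair

variable {𝒯 ℱ : ObjectProperty (ModuleCat.{u} A)} (h : IsTorsionPair 𝒯 ℱ)
  {X Y Z : Type u} [AddCommGroup X] [Module A X] [AddCommGroup Y] [Module A Y]
  [AddCommGroup Z] [Module A Z]

include h

theorem finite (hX : 𝒯 (ModuleCat.of A X)) : Module.Finite A X :=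
  h.torsion_le _ hX

/-- The torsion submodule of a finitely generated module. -/
theorem exists_torsion_submodule (X : Type u) [AddCommGroup X] [Module A X] [Module.Finite A X] :
    ∃ N : Submodule A X, 𝒯 (ModuleCat.of A N) ∧ ℱ (ModuleCat.of A (X ⧸ N)) := by
  obtain ⟨S, hS, ⟨e⟩, h₁, h₃⟩ := h.exists_shortExact (ModuleCat.of A X) ‹_›
  let i : S.X₁ →ₗ[A] X := e.toLinearEquiv.toLinearMap ∘ₗ S.f.hom
  have hi : Function.Injective i :=
    e.toLinearEquiv.injective.comp hS.moduleCat_injective_f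
  let p : X →ₗ[A] S.X₃ := S.g.hom ∘ₗ e.symm.toLinearEquiv.toLinearMap
  have hp : Function.Surjective p :=
    hS.moduleCat_surjective_g.comp e.symm.toLinearEquiv.surjective
  refine ⟨LinearMap.range i, h.torsion_isModuleClass.of_equiv h₁ (LinearEquiv.ofInjective i hi),
    h.torsionFree_isModuleClass.of_equiv h₃
      ((Submodule.quotEquivOfEq _ _ ?_).trans (p.quotKerEquivOfSurjective hp)).symm⟩
  have hex : Function.Exact S.f.hom S.g.hom :=
    (ShortComplex.ShortExact.moduleCat_exact_iff_function_exact S).1 hS.exact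
  ext x
  simp only [LinearMap.mem_range, LinearMap.mem_ker]
  have := hex (e.symm.toLinearEquiv x)
  change (_ ↔ ∃ y, _) at this
  change (∃ y, e.toLinearEquiv (S.f.hom y) = x) ↔ S.g.hom (e.symm.toLinearEquiv x) = 0
  rw [this]
  exact exists_congr fun y => (e.toLinearEquiv.eq_symm_apply (x := x)).symm

/-- If `X` has no nonzero map to `ℱ`, the projection onto its torsion-free quotient vanishes, so the
torsion submodule is everything. Closure under quotients and extensions follows from this
description. -/
theorem mem_iff : 𝒯 (ModuleCat.of A X) ↔ Module.Finite A X ∧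
    ∀ Y : ModuleCat.{u} A, ℱ Y → ∀ f : X →ₗ[A] Y, f = 0 := by
  constructor
  · intro hX
    exact ⟨h.finite hX, fun Y hY f =>
      congrArg ModuleCat.Hom.hom (h.hom_eq_zero hX hY (ModuleCat.ofHom f))⟩
  · rintro ⟨hfin, hX⟩
    obtain ⟨N, h₁, h₃⟩ := h.exists_torsion_submodule X
    have : N = ⊤ := by
      rw [← N.ker_mkQ, hX _ h₃ N.mkQ, LinearMap.ker_zero]
    subst this
    exact h.torsion_isModuleClass.of_equiv h₁ Submodule.topEquiv

theorem of_surjective (hX : 𝒯 (ModuleCat.of A X)) {f : X →ₗ[A] Y} (hf : Function.Surjective f) :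
    𝒯 (ModuleCat.of A Y) := by
  obtain ⟨hfin, hX⟩ := h.mem_iff.1 hX
  refine h.mem_iff.2 ⟨.of_surjective f hf, fun F hF g => ?_⟩
  exact (LinearMap.cancel_right hf).1 ((hX F hF (g ∘ₗ f)).trans (LinearMap.zero_comp f).symm)

theorem of_exact (hX : 𝒯 (ModuleCat.of A X)) (hZ : 𝒯 (ModuleCat.of A Z)) {i : X →ₗ[A] Y}
    {p : Y →ₗ[A] Z} (hp : Function.Surjective p) (hex : Function.Exact i p) :
    𝒯 (ModuleCat.of A Y) := by
  obtain ⟨hfinX, hX⟩ := h.mem_iff.1 hX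
  obtain ⟨hfinZ, hZ⟩ := h.mem_iff.1 hZ
  have hker := hex.linearMap_ker_eq
  have hfin : Module.Finite A Y := by
    have h₁ : Module.Finite A (LinearMap.ker p) := by
      rw [hker]; exact Module.Finite.range i
    have h₂ : Module.Finite A (Y ⧸ LinearMap.ker p) :=
      Module.Finite.equiv (p.quotKerEquivOfSurjective hp).symm
    exact Module.Finite.of_submodule_quotient (LinearMap.ker p)
  refine h.mem_iff.2 ⟨hfin, fun F hF g => ?_⟩
  have hg : LinearMap.ker p ≤ LinearMap.ker g := by
    rw [hker, LinearMap.range_le_ker_iff]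
    exact hX F hF _
  have hg' := hZ F hF
    ((LinearMap.ker p).liftQ g hg ∘ₗ (p.quotKerEquivOfSurjective hp).symm.toLinearMap)
  ext y
  have := LinearMap.congr_fun hg' (p y)
  rw [LinearMap.comp_apply, LinearEquiv.coe_coe,
    show p y = p.quotKerEquivOfSurjective hp ((LinearMap.ker p).mkQ y) from rfl,
    LinearEquiv.symm_apply_apply] at this
  simpa using this

theorem pi (hX : 𝒯 (ModuleCat.of A X)) (n : ℕ) : 𝒯 (ModuleCat.of A (Fin n → X)) :=
  h.torsion_isModuleClass.pi hX n

theorem gen_le {X : ModuleCat.{u} A} (hX : 𝒯 X) : gen X ≤ 𝒯 := fun _ hY => by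
  obtain ⟨n, f, hf⟩ := gen_iff.1 hY
  exact h.of_surjective (h.pi hX n) hf

theorem eq_gen {X : ModuleCat.{u} A} (hX : 𝒯 X) (hle : 𝒯 ≤ gen X) : 𝒯 = gen X :=
  le_antisymm hle (h.gen_le hX)

end IsTorsionPair

end Classes


/-! ### Approximations by powers of a module, from finite-dimensionality of `Hom`. -/

section HomGenerators

variable (K : Type w) [Field K] (A : Type u) [Ring A] [Algebra K A] [FiniteDimensional K A]
  (X Y : Type u) [AddCommGroup X] [Module A X] [AddCommGroup Y] [Module A Y]
  [Module.Finite A X] [Module.Finite A Y]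

/-- `Hom(X, Y)` is finite-dimensional. -/
theorem exists_hom_generators : ∃ (n : ℕ) (f : Fin n → X →ₗ[A] Y), ∀ g : X →ₗ[A] Y,
    ∃ c : Fin n → K, ∀ x, g x = ∑ i, algebraMap K A (c i) • f i x := by
  let : Module K X := Module.compHom X (algebraMap K A)
  let : Module K Y := Module.compHom Y (algebraMap K A)
  have : IsScalarTower K A X := .of_algebraMap_smul fun _ _ => rfl
  have : IsScalarTower K A Y := .of_algebraMap_smul fun _ _ => rfl
  have : Module.Finite K X := .trans A X
  have : Module.Finite K Y := .trans A Y
  let φ : (X →ₗ[A] Y) →ₗ[K] (X →ₗ[K] Y) :=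
    { toFun := fun f => f.restrictScalars K
      map_add' := fun _ _ => rfl
      map_smul' := fun _ _ => rfl }
  have hφ : Function.Injective φ := LinearMap.restrictScalars_injective K
  have : Module.Finite K (X →ₗ[A] Y) := Module.Finite.of_injective φ hφ
  let b := Module.finBasis K (X →ₗ[A] Y)
  refine ⟨_, b, fun g => ⟨b.repr g, fun x => ?_⟩⟩
  conv_lhs => rw [← b.sum_repr g]
  rw [LinearMap.sum_apply]
  rfl

/-- Multiplication by a scalar of the ground field. -/
def scalarEnd (Y : Type u) [AddCommGroup Y] [Module A Y] (c : K) : Y →ₗ[A] Y where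
  toFun y := algebraMap K A c • y
  map_add' := smul_add _
  map_smul' a y := by rw [RingHom.id_apply, smul_smul, smul_smul, Algebra.commutes]

include K in
/-- `X` has a left approximation by powers of `Y`. -/
theorem exists_left_add_approx : ∃ (n : ℕ) (φ : X →ₗ[A] (Fin n → Y)), ∀ g : X →ₗ[A] Y,
    ∃ h : (Fin n → Y) →ₗ[A] Y, h ∘ₗ φ = g := by
  obtain ⟨n, f, hf⟩ := exists_hom_generators K A X Y
  refine ⟨n, LinearMap.pi f, fun g => ?_⟩
  obtain ⟨c, hc⟩ := hf g
  refine ⟨∑ i, scalarEnd K A Y (c i) ∘ₗ LinearMap.proj i, LinearMap.ext fun x => ?_⟩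
  rw [hc, LinearMap.comp_apply, LinearMap.sum_apply]
  rfl

include K in
/-- `Y` has a right approximation by powers of `X`. -/
theorem exists_right_add_approx : ∃ (n : ℕ) (φ : (Fin n → X) →ₗ[A] Y), ∀ g : X →ₗ[A] Y,
    ∃ h : X →ₗ[A] (Fin n → X), φ ∘ₗ h = g := by
  obtain ⟨n, f, hf⟩ := exists_hom_generators K A X Y
  refine ⟨n, ∑ i, f i ∘ₗ LinearMap.proj i, fun g => ?_⟩
  obtain ⟨c, hc⟩ := hf g
  refine ⟨LinearMap.pi fun i => scalarEnd K A X (c i), LinearMap.ext fun x => ?_⟩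
  rw [hc, LinearMap.comp_apply, LinearMap.sum_apply]
  exact Finset.sum_congr rfl fun i _ => (f i).map_smul _ _

end HomGenerators

/-! ### Envelopes and covers for torsion classes. -/

section Approximation

variable {A : Type u} [Ring A] [IsArtinianRing A]

/-- A left approximation can be refined to an envelope. -/
theorem exists_envelope_of_factor {C : ObjectProperty (ModuleCat.{u} A)}
    (hC : ∀ ⦃X Y : ModuleCat.{u} A⦄ (f : X ⟶ Y), C X → Function.Surjective f → C Y)
    {X : ModuleCat.{u} A} (U : ModuleCat.{u} A) [hfin : Module.Finite A U] (θ : X ⟶ U) (hU : C U)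
    (hθ : ∀ ⦃Z : ModuleCat.{u} A⦄, C Z → ∀ f : X ⟶ Z, ∃ g : U ⟶ Z, θ ≫ g = f) :
    ∃ (Y : ModuleCat.{u} A) (θ : X ⟶ Y), IsEnvelope C θ := by
  induction hn : Module.length A U using WellFoundedLT.induction generalizing U with
  | _ n ih =>
    by_cases hmin : IsCodomainMinimal θ
    · exact ⟨U, θ, hU, hθ, hmin⟩
    · simp only [IsCodomainMinimal, not_forall] at hmin
      obtain ⟨α, hα, hiso⟩ := hmin
      -- Surjective endomorphisms of Noetherian modules are bijective, so a non-invertible `α`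
      -- fixing `θ` has proper image; corestricting `θ` to that image keeps the factorization
      -- property and lowers the length.
      have hsurj : ¬ Function.Surjective α.hom := fun hs => hiso <| by
        have hb : Function.Bijective α.hom :=
          ⟨IsNoetherian.injective_of_surjective_endomorphism α.hom hs, hs⟩
        exact (LinearEquiv.ofBijective α.hom hb).toModuleIso.isIso_hom
      have hlt : Module.length A (LinearMap.range α.hom) < n :=
        hn ▸ Submodule.length_lt fun h => hsurj (LinearMap.range_eq_top.1 h)
      let V := ModuleCat.of A (LinearMap.range α.hom)
      let ρ : U ⟶ V := ModuleCat.ofHom α.hom.rangeRestrict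
      let ι : V ⟶ U := ModuleCat.ofHom (LinearMap.range α.hom).subtype
      have hρι : ρ ≫ ι = α := rfl
      refine ih _ hlt V (hfin := inferInstanceAs (Module.Finite A (LinearMap.range α.hom)))
        (θ ≫ ρ) (hC ρ hU α.hom.surjective_rangeRestrict) (fun Z hZ f => ?_) rfl
      obtain ⟨g, hg⟩ := hθ hZ f
      exact ⟨ι ≫ g, by rw [Category.assoc, ← Category.assoc ρ, hρι, ← Category.assoc, hα, hg]⟩

variable {𝒯 ℱ : ObjectProperty (ModuleCat.{u} A)} (h : IsTorsionPair 𝒯 ℱ)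

include h

omit [IsArtinianRing A] in
/-- The inclusion of the torsion submodule is a cover. -/
theorem IsTorsionPair.isContravariantlyFinite : IsContravariantlyFinite 𝒯 := by
  intro X hX
  have : Module.Finite A X := hX
  obtain ⟨N, hN, hQ⟩ := h.exists_torsion_submodule X
  refine ⟨ModuleCat.of A N, ModuleCat.ofHom N.subtype, hN, fun Z hZ f => ?_, fun β hβ => ?_⟩
  · have h0 := (h.mem_iff.1 hZ).2 _ hQ (N.mkQ ∘ₗ f.hom)
    refine ⟨ModuleCat.ofHom (f.hom.codRestrict N fun z => ?_), rfl⟩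
    simpa using LinearMap.congr_fun h0 z
  · have hm : Mono (ModuleCat.ofHom N.subtype) :=
      (ModuleCat.mono_iff_injective _).2 N.injective_subtype
    have : β = 𝟙 _ := by rw [← cancel_mono (ModuleCat.ofHom N.subtype), hβ, Category.id_comp]
    rw [this]
    infer_instance

/-- `gen X` has envelopes. -/
theorem IsTorsionPair.isCovariantlyFinite_of_eq_gen (K : Type w) [Field K] [Algebra K A]
    [FiniteDimensional K A] (X : ModuleCat.{u} A) [Module.Finite A X] (hX : 𝒯 = gen X) :
    IsCovariantlyFinite 𝒯 := by
  intro Y hY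
  have : Module.Finite A Y := hY
  obtain ⟨m, q, hq⟩ := Module.Finite.exists_fin' A Y
  obtain ⟨n, φ, hφ⟩ := exists_left_add_approx K A (Fin m → A) X
  -- The quotient of `Xⁿ` by `φ(ker q)` is the pushout of `φ` along the presentation `q`; `θ` is the
  -- induced map from `Y`.
  let N := (LinearMap.ker q).map φ
  have hN : LinearMap.ker q ≤ N.comap φ := Submodule.le_comap_map _ _
  let e := q.quotKerEquivOfSurjective hq
  let θ : Y →ₗ[A] (Fin n → X) ⧸ N := (LinearMap.ker q).mapQ N φ hN ∘ₗ e.symm.toLinearMap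
  have hθ : ∀ x, θ (q x) = N.mkQ (φ x) := fun x => by
    rw [show q x = e ((LinearMap.ker q).mkQ x) from rfl]
    simp [θ]
  have hU : gen X (ModuleCat.of A ((Fin n → X) ⧸ N)) := gen_iff.2 ⟨n, N.mkQ, N.mkQ_surjective⟩
  refine exists_envelope_of_factor (fun X Y f hX hf => h.of_surjective (f := f.hom) hX hf)
    (ModuleCat.of A ((Fin n → X) ⧸ N))
    (hfin := inferInstanceAs (Module.Finite A ((Fin n → X) ⧸ N))) (ModuleCat.ofHom θ) (hX ▸ hU) ?_
  intro Z hZ f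
  obtain ⟨k, π, hπ⟩ := gen_iff.1 (hX ▸ hZ)
  -- A map to a quotient of `Xᵏ` lifts to `Xᵏ` on the free cover of `Y`, and there factors through
  -- `φ` coordinate by coordinate.
  obtain ⟨l, hl⟩ := Module.projective_lifting_property π (f.hom ∘ₗ q) hπ
  choose g hg using fun i => hφ (LinearMap.proj i ∘ₗ l)
  have hgl : LinearMap.pi g ∘ₗ φ = l :=
    LinearMap.ext fun x => funext fun i => LinearMap.congr_fun (hg i) x
  have hfac : ∀ x, π (LinearMap.pi g (φ x)) = f.hom (q x) := fun x => by
    have h₁ := LinearMap.congr_fun hgl x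
    have h₂ := LinearMap.congr_fun hl x
    rw [LinearMap.comp_apply] at h₁ h₂
    rw [h₁, h₂, LinearMap.comp_apply]
  have hker : N ≤ LinearMap.ker (π ∘ₗ LinearMap.pi g) := by
    rintro _ ⟨x, hx, rfl⟩
    rw [LinearMap.mem_ker, LinearMap.comp_apply, hfac, LinearMap.mem_ker.1 hx, map_zero]
  refine ⟨ModuleCat.ofHom (N.liftQ _ hker), ModuleCat.hom_ext (LinearMap.ext fun y => ?_)⟩
  obtain ⟨x, rfl⟩ := hq y
  change N.liftQ _ hker (θ (q x)) = f.hom (q x)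
  rw [hθ, ← hfac]
  rfl

omit h in
omit [IsArtinianRing A] in
/-- `T` generates every finitely generated module `X` such that all maps from `A` to `X` factor
through a fixed map from `A` to `T`. -/
theorem gen_of_factor {T X : ModuleCat.{u} A} [Module.Finite A X] (θ : A →ₗ[A] T)
    (hθ : ∀ f : A →ₗ[A] X, ∃ g : T →ₗ[A] X, g ∘ₗ θ = f) : gen T X := by
  obtain ⟨m, q, hq⟩ := Module.Finite.exists_fin' A X
  choose g hg using fun i => hθ (q ∘ₗ LinearMap.single A (fun _ : Fin m => A) i)
  refine gen_iff.2 ⟨m, ∑ i, g i ∘ₗ LinearMap.proj i, fun x => ?_⟩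
  obtain ⟨y, rfl⟩ := hq x
  refine ⟨fun i => θ (y i), ?_⟩
  have hgi : ∀ i, g i (θ (y i)) = q (Pi.single i (y i)) := fun i =>
    LinearMap.congr_fun (hg i) (y i)
  simp only [LinearMap.sum_apply, LinearMap.comp_apply, LinearMap.proj_apply, hgi]
  rw [← map_sum, Finset.univ_sum_single]

omit [IsArtinianRing A] in
/-- An envelope of `A` generates the torsion class. -/
theorem IsTorsionPair.eq_gen_of_isEnvelope {T : ModuleCat.{u} A} {θ : ModuleCat.of A A ⟶ T}
    (hθ : IsEnvelope 𝒯 θ) : 𝒯 = gen T := by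
  refine h.eq_gen hθ.mem fun X hX => ?_
  have := h.finite hX
  refine gen_of_factor θ.hom fun f => ?_
  obtain ⟨g, hg⟩ := hθ.exists_factor hX (ModuleCat.ofHom f)
  exact ⟨g.hom, congrArg ModuleCat.Hom.hom hg⟩

end Approximation


/-! ### Closure properties of Ext-projective modules and a criterion for generation. -/

section ExtProjective

variable {A : Type u} [Ring A] {C : ObjectProperty (ModuleCat.{u} A)}
  {M N Y E F T : Type u} [AddCommGroup M] [Module A M] [AddCommGroup N] [Module A N]
  [AddCommGroup Y] [Module A Y] [AddCommGroup E] [Module A E] [AddCommGroup F] [Module A F]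
  [AddCommGroup T] [Module A T]

theorem IsExtProjective.exists_lift (hM : IsExtProjective C (ModuleCat.of A M))
    (hY : C (ModuleCat.of A Y)) {i : Y →ₗ[A] E} {p : E →ₗ[A] F}
    (hi : Function.Injective i) (hp : Function.Surjective p) (h : Function.Exact i p)
    (f : M →ₗ[A] F) : ∃ g : M →ₗ[A] E, p ∘ₗ g = f :=
  ExtVanish.exists_lift (hM.2 _ hY) hi hp h f

theorem IsExtProjective.of_lift (hM : C (ModuleCat.of A M))
    (hlift : ∀ (Y E F : Type u) [AddCommGroup Y] [Module A Y] [AddCommGroup E] [Module A E]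
      [AddCommGroup F] [Module A F] (i : Y →ₗ[A] E) (p : E →ₗ[A] F), C (ModuleCat.of A Y) →
      Function.Injective i → Function.Surjective p → Function.Exact i p →
      ∀ f : M →ₗ[A] F, ∃ g : M →ₗ[A] E, p ∘ₗ g = f) : IsExtProjective C (ModuleCat.of A M) :=
  ⟨hM, fun Y hY => ExtVanish.of_lift A M Y fun E F _ _ _ _ i p => hlift Y E F i p hY⟩

theorem IsExtProjective.of_retract (hC : IsModuleClass C)
    (hM : IsExtProjective C (ModuleCat.of A M)) {s : N →ₗ[A] M} {r : M →ₗ[A] N}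
    (hrs : r ∘ₗ s = LinearMap.id) : IsExtProjective C (ModuleCat.of A N) := by
  refine .of_lift (hC.of_retract hM.1 hrs) fun Y E F _ _ _ _ _ _ i p hY hi hp h f => ?_
  obtain ⟨g, hg⟩ := hM.exists_lift hY hi hp h (f ∘ₗ r)
  exact ⟨g ∘ₗ s, by rw [← LinearMap.comp_assoc, hg, LinearMap.comp_assoc, hrs, LinearMap.comp_id]⟩

theorem IsExtProjective.directSum {ι : Type u} {M : ι → Type u} [∀ i, AddCommGroup (M i)]
    [∀ i, Module A (M i)] (hM : ∀ i, IsExtProjective C (ModuleCat.of A (M i)))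
    (hC : C (ModuleCat.of A (⨁ i, M i))) : IsExtProjective C (ModuleCat.of A (⨁ i, M i)) := by
  classical
  refine .of_lift hC fun Y E F _ _ _ _ _ _ i p hY hi hp h f => ?_
  choose g hg using fun j => (hM j).exists_lift hY hi hp h (f ∘ₗ DirectSum.lof A ι M j)
  refine ⟨DirectSum.toModule A ι E g, ?_⟩
  ext j x
  simpa using LinearMap.congr_fun (hg j) x

theorem IsExtProjective.pi (hC : IsModuleClass C) (hM : IsExtProjective C (ModuleCat.of A M))
    (n : ℕ) : IsExtProjective C (ModuleCat.of A (Fin n → M)) := by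
  refine .of_lift (hC.pi hM.1 n) fun Y E F _ _ _ _ _ _ i p hY hi hp h f => ?_
  choose g hg using fun j => hM.exists_lift hY hi hp h
    (f ∘ₗ LinearMap.single A (fun _ : Fin n => M) j)
  refine ⟨∑ j, g j ∘ₗ LinearMap.proj j, ?_⟩
  ext j x
  have : (∑ k, g k ∘ₗ LinearMap.proj k) (Pi.single j x) = g j x := by
    rw [LinearMap.sum_apply, Finset.sum_eq_single j]
    · simp
    · intro k _ hk
      simp [hk]
    · simp
  change p ((∑ k, g k ∘ₗ LinearMap.proj k) (Pi.single j x)) = f (Pi.single j x)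
  rw [this]
  exact LinearMap.congr_fun (hg j) x

theorem IsExtProjective.prod (hC : IsModuleClass C) (hM : IsExtProjective C (ModuleCat.of A M))
    (hN : IsExtProjective C (ModuleCat.of A N)) : IsExtProjective C (ModuleCat.of A (M × N)) := by
  refine .of_lift (hC.prod_iff.2 ⟨hM.1, hN.1⟩) fun Y E F _ _ _ _ _ _ i p hY hi hp h f => ?_
  obtain ⟨g, hg⟩ := hM.exists_lift hY hi hp h (f ∘ₗ LinearMap.inl A M N)
  obtain ⟨g', hg'⟩ := hN.exists_lift hY hi hp h (f ∘ₗ LinearMap.inr A M N)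
  exact ⟨g.coprod g', by rw [LinearMap.comp_coprod, hg, hg', ← LinearMap.comp_coprod,
    LinearMap.coprod_inl_inr, LinearMap.comp_id]⟩

theorem IsExtProjective.of_isSummandOfPower (hC : IsModuleClass C)
    (hM : IsExtProjective C (ModuleCat.of A M)) (h : IsSummandOfPower A M N) :
    IsExtProjective C (ModuleCat.of A N) := by
  obtain ⟨n, s, r, hrs⟩ := h
  exact (hM.pi hC n).of_retract hC hrs

/-- If `Ext¹(T ⧸ θ(A), X) = 0` then `T` generates `X`. -/
theorem gen_of_extVanish (θ : A →ₗ[A] T) [Module.Finite A M]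
    (hker : ∀ a, θ a = 0 → ∀ x : M, a • x = 0) (hext : ExtVanish A (T ⧸ LinearMap.range θ) M) :
    gen (ModuleCat.of A T) (ModuleCat.of A M) := by
  refine gen_of_factor (X := ModuleCat.of A M) (T := ModuleCat.of A T) θ fun f => ?_
  -- Since `f a = a • f 1`, the map `f` kills `ker θ` and descends to `θ(A)`, from where it extends
  -- to `T`.
  have hle : LinearMap.ker θ ≤ LinearMap.ker f := fun a ha => by
    rw [LinearMap.mem_ker, ← mul_one a, ← smul_eq_mul, map_smul]
    exact hker a ha _
  obtain ⟨g, hg⟩ := hext.exists_extend (LinearMap.range θ).injective_subtype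
    (LinearMap.range θ).mkQ_surjective (LinearMap.exact_subtype_mkQ _)
    ((LinearMap.ker θ).liftQ f hle ∘ₗ θ.quotKerEquivRange.symm.toLinearMap)
  refine ⟨g, LinearMap.ext fun a => ?_⟩
  have := LinearMap.congr_fun hg (θ.rangeRestrict a)
  rw [LinearMap.comp_apply, LinearMap.comp_apply, LinearEquiv.coe_coe,
    show θ.rangeRestrict a = θ.quotKerEquivRange ((LinearMap.ker θ).mkQ a) from rfl,
    LinearEquiv.symm_apply_apply] at this
  exact this

end ExtProjective

/-! ### The envelope of the regular module and its cokernel. -/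

section Envelope

variable {A : Type u} [Ring A] {𝒯 ℱ : ObjectProperty (ModuleCat.{u} A)} (h : IsTorsionPair 𝒯 ℱ)
  {T : ModuleCat.{u} A} {θ : ModuleCat.of A A ⟶ T} (hθ : IsEnvelope 𝒯 θ)

include hθ

theorem IsEnvelope.exists_linearMap {X : Type u} [AddCommGroup X] [Module A X]
    (hX : 𝒯 (ModuleCat.of A X)) (f : A →ₗ[A] X) : ∃ g : T →ₗ[A] X, g ∘ₗ θ.hom = f := by
  obtain ⟨g, hg⟩ := hθ.exists_factor hX (ModuleCat.ofHom f)
  exact ⟨g.hom, congrArg ModuleCat.Hom.hom hg⟩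

theorem IsEnvelope.smul_eq_zero {X : Type u} [AddCommGroup X] [Module A X]
    (hX : 𝒯 (ModuleCat.of A X)) {a : A} (ha : θ.hom a = 0) (x : X) : a • x = 0 := by
  obtain ⟨g, hg⟩ := hθ.exists_linearMap hX (LinearMap.toSpanSingleton A X x)
  rw [← LinearMap.toSpanSingleton_apply, ← hg, LinearMap.comp_apply, ha, map_zero]

include h

/-- The envelope of `A` is Ext-projective. -/
theorem IsEnvelope.isExtProjective : IsExtProjective 𝒯 T := by
  refine .of_lift (M := T) hθ.mem fun Y E F _ _ _ _ _ _ i p hY hi hp hex f => ?_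
  -- The pullback of `p` and `f` is an extension of `T` by `Y`, hence lies in `𝒯`; a lift of `f ∘ θ`
  -- to `E` gives a map `A → P`, which factors through `θ`.
  let P : Submodule A (E × T) :=
    LinearMap.eqLocus (p ∘ₗ LinearMap.fst A E T) (f ∘ₗ LinearMap.snd A E T)
  have hP : 𝒯 (ModuleCat.of A P) := by
    let j : Y →ₗ[A] P := LinearMap.codRestrict P (LinearMap.inl A E T ∘ₗ i) fun y => by
      simp [P, hex.apply_apply_eq_zero]
    refine h.of_exact hY hθ.mem (i := j) (p := LinearMap.snd A E T ∘ₗ P.subtype) ?_ ?_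
    · intro t
      obtain ⟨e, he⟩ := hp (f t)
      exact ⟨⟨(e, t), he⟩, rfl⟩
    · rintro ⟨⟨e, t⟩, het⟩
      change t = 0 ↔ _
      constructor
      · rintro rfl
        replace het : p e = f 0 := het
        rw [map_zero] at het
        obtain ⟨y, rfl⟩ := (hex e).1 het
        exact ⟨y, rfl⟩
      · rintro ⟨y, hy⟩
        exact (congrArg (fun z : P => z.1.2) hy).symm
  obtain ⟨l, hl⟩ := Module.projective_lifting_property p (f ∘ₗ θ.hom) hp
  obtain ⟨s, hs⟩ := hθ.exists_linearMap hP
    (LinearMap.codRestrict P (l.prod θ.hom) fun a => LinearMap.congr_fun hl a)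
  -- The composite `T → P → T` fixes `θ`, so minimality makes it invertible; correcting `s` by its
  -- inverse splits `P → T`.
  let α : T →ₗ[A] T := LinearMap.snd A E T ∘ₗ P.subtype ∘ₗ s
  have hα : IsIso (ModuleCat.ofHom α) := by
    refine hθ.minimal _ (ModuleCat.hom_ext (LinearMap.ext fun a => ?_))
    exact congrArg (fun z : P => z.1.2) (LinearMap.congr_fun hs a)
  let e := (asIso (ModuleCat.ofHom α)).toLinearEquiv
  have he : ∀ x, α (e.symm x) = x := fun x => e.apply_symm_apply x
  refine ⟨LinearMap.fst A E T ∘ₗ P.subtype ∘ₗ s ∘ₗ e.symm.toLinearMap, LinearMap.ext fun x => ?_⟩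
  have : p (s (e.symm x)).1.1 = f (α (e.symm x)) := (s (e.symm x)).2
  rw [he] at this
  exact this

/-- The cokernel of the envelope of `A` is Ext-projective. -/
theorem IsEnvelope.isExtProjective_coker :
    IsExtProjective 𝒯 (ModuleCat.of A (T ⧸ LinearMap.range θ.hom)) := by
  refine ⟨h.of_surjective hθ.mem (LinearMap.range θ.hom).mkQ_surjective, fun Y hY => ?_⟩
  refine ExtVanish.of_cokernel (Y := Y) (LinearMap.range θ.hom).injective_subtype
    (LinearMap.range θ.hom).mkQ_surjective (LinearMap.exact_subtype_mkQ _)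
    ((hθ.isExtProjective h).2 Y hY) fun f => ?_
  obtain ⟨g, hg⟩ := hθ.exists_linearMap hY (f ∘ₗ θ.hom.rangeRestrict)
  refine ⟨g, LinearMap.ext ?_⟩
  rintro ⟨_, a, rfl⟩
  exact LinearMap.congr_fun hg a

/-- Every Ext-projective module is a direct summand of a power of the direct sum of the envelope of
`A` and its cokernel. -/
theorem IsEnvelope.isSummandOfPower (K : Type w) [Field K] [Algebra K A] [FiniteDimensional K A]
    {M : Type u} [AddCommGroup M] [Module A M] (hM : IsExtProjective 𝒯 (ModuleCat.of A M)) :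
    IsSummandOfPower A (T × (T ⧸ LinearMap.range θ.hom)) M := by
  have : IsNoetherianRing A := IsNoetherianRing.of_finite K A
  let D := T × (T ⧸ LinearMap.range θ.hom)
  have hT₁ := hθ.isExtProjective_coker h
  have hD : 𝒯 (ModuleCat.of A D) :=
    h.torsion_isModuleClass.prod_iff.2 ⟨hθ.mem, hT₁.1⟩
  have hDfin : Module.Finite A D := h.finite hD
  have hMfin : Module.Finite A M := h.finite hM.1
  obtain ⟨r, φ, hφ⟩ := exists_right_add_approx K A D M
  have hgen : gen T (ModuleCat.of A M) := h.eq_gen_of_isEnvelope hθ ▸ hM.1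
  have hsurj : Function.Surjective φ := by
    obtain ⟨n, p, hp⟩ := gen_iff.1 hgen
    intro x
    obtain ⟨y, rfl⟩ := hp x
    choose g hg using fun i => hφ
      -- Each component `T → M` of `p` is extended by zero to `D`, so that it factors through `φ`.
      (p ∘ₗ LinearMap.single A (fun _ : Fin n => (T : Type u)) i ∘ₗ LinearMap.fst A T _)
    refine ⟨∑ i, g i (y i, 0), ?_⟩
    have hgi : ∀ i, φ (g i (y i, 0)) = p (Pi.single i (y i)) := fun i =>
      LinearMap.congr_fun (hg i) (y i, 0)
    simp only [map_sum, hgi]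
    rw [← map_sum, Finset.univ_sum_single]
  have hDr := h.pi hD r
  -- Maps `T₁ → M` lift along `φ` because `T₁` is a summand of `D`; this yields `Ext¹(T₁, ker φ) =
  -- 0`, and then `T` generates `ker φ`.
  have hN : 𝒯 (ModuleCat.of A (LinearMap.ker φ)) := by
    have hext : ExtVanish A (T ⧸ LinearMap.range θ.hom) (LinearMap.ker φ) := by
      refine ExtVanish.of_kernel (LinearMap.ker φ).injective_subtype hsurj
        (LinearMap.exact_subtype_ker_map φ) (hT₁.2 _ hDr) fun f => ?_
      obtain ⟨g, hg⟩ := hφ (f ∘ₗ LinearMap.snd A T _)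
      exact ⟨g ∘ₗ LinearMap.inr A T _, by
        rw [← LinearMap.comp_assoc, hg, LinearMap.comp_assoc, LinearMap.snd_comp_inr,
          LinearMap.comp_id]⟩
    rw [h.eq_gen_of_isEnvelope hθ]
    refine gen_of_extVanish θ.hom (fun a ha x => ?_) hext
    exact Subtype.ext (hθ.smul_eq_zero hDr ha x.1)
  obtain ⟨s, hs⟩ := hM.exists_lift hN (LinearMap.ker φ).injective_subtype hsurj
    (LinearMap.exact_subtype_ker_map φ) LinearMap.id
  exact ⟨r, s, φ, hs⟩

end Envelope


/-! ### Local endomorphism rings and decompositions into indecomposables. -/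

section KrullSchmidt

variable {A : Type u} [Ring A] {M X Y : Type u} [AddCommGroup M] [Module A M]
  [AddCommGroup X] [Module A X] [AddCommGroup Y] [Module A Y]

/-- `M` is isomorphic to a direct summand of `X`. -/
def IsDirectSummand (A : Type u) [Ring A] (M X : Type u) [AddCommGroup M] [Module A M]
    [AddCommGroup X] [Module A X] : Prop :=
  ∃ (s : M →ₗ[A] X) (r : X →ₗ[A] M), r ∘ₗ s = LinearMap.id

theorem IsDirectSummand.trans (h : IsDirectSummand A M X) (h' : IsDirectSummand A X Y) :
    IsDirectSummand A M Y := by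
  obtain ⟨s, r, hrs⟩ := h
  obtain ⟨s', r', hrs'⟩ := h'
  refine ⟨s' ∘ₗ s, r ∘ₗ r', ?_⟩
  rw [LinearMap.comp_assoc, ← LinearMap.comp_assoc s, hrs', LinearMap.id_comp, hrs]

theorem IsDirectSummand.of_equiv (e : M ≃ₗ[A] X) : IsDirectSummand A M X :=
  ⟨e.toLinearMap, e.symm.toLinearMap, by ext; simp⟩

theorem subsingleton_of_isZero (h : IsZero (ModuleCat.of A M)) : Subsingleton M :=
  ModuleCat.subsingleton_of_isZero h

theorem nontrivial_of_indecomposable (h : Indecomposable (ModuleCat.of A M)) : Nontrivial M := by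
  rw [← not_subsingleton_iff_nontrivial]
  intro hs
  exact h.1 (ModuleCat.isZero_of_subsingleton _)

theorem subsingleton_or_of_indecomposable (h : Indecomposable (ModuleCat.of A M))
    (e : M ≃ₗ[A] X × Y) : Subsingleton X ∨ Subsingleton Y :=
  (h.2 (ModuleCat.of A X) (ModuleCat.of A Y)
    (e.toModuleIso ≪≫ (ModuleCat.biprodIsoProd (ModuleCat.of A X) (ModuleCat.of A Y)).symm)).imp
    subsingleton_of_isZero subsingleton_of_isZero

theorem indecomposable_of_iso {X Y : ModuleCat.{u} A} (h : Indecomposable X) (e : X ≅ Y) :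
    Indecomposable Y :=
  ⟨fun hz => h.1 (hz.of_iso e), fun Z W i => h.2 Z W (e ≪≫ i)⟩

/-- The endomorphism ring of an indecomposable module of finite length is local. -/
theorem isLocalRing_end_of_indecomposable [IsArtinian A M] [IsNoetherian A M]
    (h : Indecomposable (ModuleCat.of A M)) : IsLocalRing (Module.End A M) := by
  have := nontrivial_of_indecomposable h
  refine IsLocalRing.of_isUnit_or_isUnit_one_sub_self fun f => ?_
  -- Fitting's lemma: by indecomposability either the kernel or the range of `f ^ n` is zero, so `f`
  -- is invertible or nilpotent. Taking `n ≥ 1` lets invertibility pass from `f ^ n` to `f`.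
  obtain ⟨n, hn, hn0⟩ := (f.eventually_isCompl_ker_pow_range_pow.and
    (Filter.eventually_ge_atTop 1)).exists
  rcases subsingleton_or_of_indecomposable h (Submodule.prodEquivOfIsCompl _ _ hn).symm with hs | hs
  · left
    have hker : LinearMap.ker (f ^ n) = ⊥ := Submodule.eq_bot_of_subsingleton
    rw [hker] at hn
    rw [← isUnit_pow_iff (n := n) (by omega), Module.End.isUnit_iff]
    exact ⟨LinearMap.ker_eq_bot.1 hker, LinearMap.range_eq_top.1 (by
      rw [← hn.sup_eq_top, bot_sup_eq])⟩
  · right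
    have hr : LinearMap.range (f ^ n) = ⊥ := Submodule.eq_bot_of_subsingleton
    exact IsNilpotent.isUnit_one_sub ⟨n, LinearMap.range_eq_bot.1 hr⟩

theorem isDirectSummand_of_isUnit {s : M →ₗ[A] X} {r : X →ₗ[A] M}
    (h : IsUnit (r ∘ₗ s : Module.End A M)) : IsDirectSummand A M X := by
  obtain ⟨v, hv⟩ := h.exists_left_inv
  exact ⟨s, v ∘ₗ r, hv⟩

/-- The identity of `M` is the sum of its two composites through `X` and `Y`; in a local ring one of
them is a unit. -/
theorem IsDirectSummand.left_or_right [IsLocalRing (Module.End A M)]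
    (h : IsDirectSummand A M (X × Y)) : IsDirectSummand A M X ∨ IsDirectSummand A M Y := by
  obtain ⟨s, r, hrs⟩ := h
  refine (IsLocalRing.isUnit_or_isUnit_of_add_one
    (a := ((r ∘ₗ LinearMap.inl A X Y) ∘ₗ (LinearMap.fst A X Y ∘ₗ s) : Module.End A M))
    (b := (r ∘ₗ LinearMap.inr A X Y) ∘ₗ (LinearMap.snd A X Y ∘ₗ s)) ?_).imp
    isDirectSummand_of_isUnit isDirectSummand_of_isUnit
  refine LinearMap.ext fun x => ?_
  have : r (s x) = x := LinearMap.congr_fun hrs x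
  change r ((s x).1, 0) + r (0, (s x).2) = x
  rw [← map_add, Prod.mk_add_mk, add_zero, zero_add, this]

theorem IsSummandOfPower.isDirectSummand [IsLocalRing (Module.End A M)]
    (h : IsSummandOfPower A X M) : IsDirectSummand A M X := by
  obtain ⟨n, s, r, hrs⟩ := h
  obtain ⟨i, -, hi⟩ := IsLocalRing.exists_of_isUnit_sum (s := Finset.univ)
    (f := fun i => ((r ∘ₗ LinearMap.single A (fun _ : Fin n => X) i) ∘ₗ (LinearMap.proj i ∘ₗ s) :
      Module.End A M)) <| by
    convert isUnit_one
    refine LinearMap.ext fun x => ?_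
    have : r (s x) = x := LinearMap.congr_fun hrs x
    rw [LinearMap.sum_apply]
    change ∑ i, r (Pi.single i (s x i)) = x
    rw [← map_sum, Finset.univ_sum_single, this]
  exact isDirectSummand_of_isUnit hi

theorem IsDirectSummand.nonempty_equiv [Nontrivial M] (h : IsDirectSummand A M X)
    (hX : Indecomposable (ModuleCat.of A X)) : Nonempty (M ≃ₗ[A] X) := by
  obtain ⟨s, r, hrs⟩ := h
  have := (subsingleton_or_of_indecomposable hX (prodKerEquiv s r hrs).symm).resolve_left
    (not_subsingleton M)
  exact ⟨(LinearEquiv.ofBijective r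
    ⟨LinearMap.ker_eq_bot.1 Submodule.eq_bot_of_subsingleton,
      fun x => ⟨s x, LinearMap.congr_fun hrs x⟩⟩).symm⟩

/-- Induction along decompositions into indecomposable modules. -/
theorem finDim_induction [IsArtinianRing A] {P : ModuleCat.{u} A → Prop}
    (zero : ∀ X : ModuleCat.{u} A, Subsingleton X → P X)
    (indec : ∀ X : ModuleCat.{u} A, FinDim A X → Indecomposable X → P X)
    (prod : ∀ X Y Z : ModuleCat.{u} A, Nonempty (X ≃ₗ[A] Y × Z) → P Y → P Z → P X)
    (X : ModuleCat.{u} A) (hX : FinDim A X) : P X := by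
  induction hn : Module.length A X using WellFoundedLT.induction generalizing X with
  | _ n ih =>
    by_cases hz : IsZero X
    · exact zero X (subsingleton_of_isZero hz)
    by_cases hi : Indecomposable X
    · exact indec X hX hi
    have : Module.Finite A X := hX
    simp only [Indecomposable, hz, not_false_eq_true, true_and, not_forall, not_or] at hi
    obtain ⟨Y, Z, e, hY, hZ⟩ := hi
    let e' : X ≃ₗ[A] Y × Z := (e ≪≫ ModuleCat.biprodIsoProd Y Z).toLinearEquiv
    have hYf : Module.Finite A Y :=
      .of_surjective (LinearMap.fst A Y Z ∘ₗ e'.toLinearMap)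
        (fun y => ⟨e'.symm (y, 0), by simp⟩)
    have hZf : Module.Finite A Z :=
      .of_surjective (LinearMap.snd A Y Z ∘ₗ e'.toLinearMap)
        (fun z => ⟨e'.symm (0, z), by simp⟩)
    have hYn : Nontrivial Y := by
      rw [← not_subsingleton_iff_nontrivial]
      exact fun _ => hY (ModuleCat.isZero_of_subsingleton _)
    have hZn : Nontrivial Z := by
      rw [← not_subsingleton_iff_nontrivial]
      exact fun _ => hZ (ModuleCat.isZero_of_subsingleton _)
    have hlen : Module.length A Y + Module.length A Z = n := by
      rw [← hn, e'.length_eq, Module.length_prod]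
    refine prod X Y Z ⟨e'⟩ (ih _ ?_ Y hYf rfl) (ih _ ?_ Z hZf rfl)
    · rw [← hlen, add_comm]
      exact ENat.lt_add_left Module.length_ne_top Module.length_pos
    · rw [← hlen]
      exact ENat.lt_add_left Module.length_ne_top Module.length_pos

end KrullSchmidt

/-! ### Finiteness and generation for `𝒫(𝒯)`. -/

section ExtProjSum

variable {A : Type u} [Ring A] (𝒯 : ObjectProperty (ModuleCat.{u} A))

/-- The chosen indecomposable Ext-projective module in an isomorphism class. -/
abbrev extProjSummand (q : _root_.Quotient (indecExtProjSetoid 𝒯)) : Type u := q.out.1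

theorem extProjSummand_isDirectSummand (q : _root_.Quotient (indecExtProjSetoid 𝒯)) :
    IsDirectSummand A (extProjSummand 𝒯 q) (extProjSum 𝒯) := by
  classical
  exact ⟨DirectSum.lof A _ (extProjSummand 𝒯) q, DirectSum.component A _ (extProjSummand 𝒯) q,
    LinearMap.ext fun x => DirectSum.component.lof_self A q x⟩

instance (q : _root_.Quotient (indecExtProjSetoid 𝒯)) : Nontrivial (extProjSummand 𝒯 q) :=
  nontrivial_of_indecomposable q.out.2.1

variable {𝒯}

theorem eq_of_extProjSummand_equiv {q q' : _root_.Quotient (indecExtProjSetoid 𝒯)}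
    (e : extProjSummand 𝒯 q ≃ₗ[A] extProjSummand 𝒯 q') : q = q' :=
  Quotient.out_equiv_out.1 ⟨e.toModuleIso⟩

theorem exists_extProjSummand_equiv (h𝒯 : IsModuleClass 𝒯) {X : ModuleCat.{u} A}
    [Module.Finite A X] (hX : Indecomposable X) (hE : IsExtProjective 𝒯 X) :
    ∃ q : _root_.Quotient (indecExtProjSetoid 𝒯), Nonempty (X ≃ₗ[A] extProjSummand 𝒯 q) := by
  let e := FGModuleRepr.ofFiniteEquiv A X
  let c : IndecExtProj 𝒯 := ⟨FGModuleRepr.ofFinite A X,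
    indecomposable_of_iso hX e.symm.toModuleIso,
    IsExtProjective.of_retract (M := X) h𝒯 hE (s := e.toLinearMap) (r := e.symm.toLinearMap)
      (by ext; simp)⟩
  obtain ⟨i⟩ : (⟦c⟧ : _root_.Quotient (indecExtProjSetoid 𝒯)).out ≈ c := Quotient.mk_out c
  exact ⟨⟦c⟧, ⟨e.symm.trans i.symm.toLinearEquiv⟩⟩

/-- An indecomposable module admits at most one chosen representative as a summand, and a
representative dividing a product divides one factor. This bounds the index set of `𝒫(𝒯)` without
uniqueness of decompositions. -/
theorem finite_extProjSummand [IsArtinianRing A] (X : ModuleCat.{u} A) (hX : FinDim A X) :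
    {q | IsDirectSummand A (extProjSummand 𝒯 q) X}.Finite := by
  refine finDim_induction (P := fun X => {q | IsDirectSummand A (extProjSummand 𝒯 q) X}.Finite)
    (fun X hX => ?_) (fun X _ hX => ?_) (fun X Y Z ⟨e⟩ hY hZ => ?_) X hX
  · convert Set.finite_empty
    refine Set.eq_empty_of_forall_notMem fun q ⟨s, r, hrs⟩ => ?_
    have : Function.Injective s := fun x y hxy => by
      rw [← LinearMap.id_apply (R := A) x, ← LinearMap.id_apply (R := A) y, ← hrs]
      exact congrArg r hxy
    exact not_subsingleton (extProjSummand 𝒯 q) this.subsingleton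
  · refine Set.Subsingleton.finite fun q hq q' hq' => ?_
    obtain ⟨e⟩ := IsDirectSummand.nonempty_equiv hq hX
    obtain ⟨e'⟩ := IsDirectSummand.nonempty_equiv hq' hX
    exact eq_of_extProjSummand_equiv (e.trans e'.symm)
  · refine (hY.union hZ).subset fun q hq => ?_
    have : Module.Finite A (extProjSummand 𝒯 q) :=
      inferInstanceAs (Module.Finite A (FGModuleRepr.repr q.out.1))
    have := isLocalRing_end_of_indecomposable (M := extProjSummand 𝒯 q) q.out.2.1
    exact (IsDirectSummand.trans hq (.of_equiv e)).left_or_right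

/-- Every finite-dimensional Ext-projective module lies in `add 𝒫(𝒯)`. -/
theorem IsExtProjective.isSummandOfPower_extProjSum [IsArtinianRing A] (h𝒯 : IsModuleClass 𝒯)
    {X : ModuleCat.{u} A} (hX : FinDim A X) (hE : IsExtProjective 𝒯 X) :
    IsSummandOfPower A (extProjSum 𝒯) X := by
  refine finDim_induction
    (P := fun X => IsExtProjective 𝒯 X → IsSummandOfPower A (extProjSum 𝒯) X)
    (fun X _ _ => .of_subsingleton) (fun X hfin hX hE => ?_) (fun X Y Z ⟨e⟩ hY hZ hE => ?_) X hX hE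
  · have : Module.Finite A X := hfin
    obtain ⟨q, ⟨e⟩⟩ := exists_extProjSummand_equiv h𝒯 hX hE
    obtain ⟨s, r, hrs⟩ := extProjSummand_isDirectSummand 𝒯 q
    exact ((IsSummandOfPower.refl A _).of_retract hrs).of_equiv e
  · have hprod : IsExtProjective 𝒯 (ModuleCat.of A (Y × Z)) :=
      IsExtProjective.of_retract (M := X) h𝒯 hE (s := e.symm.toLinearMap) (r := e.toLinearMap)
        (by apply LinearMap.ext; simp)
    exact ((hY (hprod.of_retract h𝒯 (LinearMap.fst_comp_inl A Y Z))).prod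
      (hZ (hprod.of_retract h𝒯 (LinearMap.snd_comp_inr A Y Z)))).of_equiv e

theorem IsTorsionPair.extProjSum_mem {ℱ : ObjectProperty (ModuleCat.{u} A)}
    (h : IsTorsionPair 𝒯 ℱ) [Module.Finite A (extProjSum 𝒯)] : 𝒯 (extProjSum 𝒯) := by
  classical
  refine h.mem_iff.2 ⟨‹_›, fun Y hY f => ?_⟩
  refine DirectSum.linearMap_ext A fun q => ?_
  exact (h.mem_iff.1 q.out.2.2.1).2 Y hY (f ∘ₗ DirectSum.lof A _ (extProjSummand 𝒯) q)

theorem isExtProjective_extProjSum (hmem : 𝒯 (extProjSum 𝒯)) :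
    IsExtProjective 𝒯 (extProjSum 𝒯) :=
  IsExtProjective.directSum (M := extProjSummand 𝒯) (fun q => q.out.2.2) hmem

/-- If `A` has an envelope then `𝒫(𝒯)` is finite-dimensional. -/
theorem IsEnvelope.finite_extProjSum {ℱ : ObjectProperty (ModuleCat.{u} A)} {T : ModuleCat.{u} A}
    {θ : ModuleCat.of A A ⟶ T} (hθ : IsEnvelope 𝒯 θ) (h : IsTorsionPair 𝒯 ℱ) (K : Type w) [Field K]
    [Algebra K A] [FiniteDimensional K A] : Module.Finite A (extProjSum 𝒯) := by
  have : IsArtinianRing A := IsArtinianRing.of_finite K A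
  let D := T × (T ⧸ LinearMap.range θ.hom)
  have hD : 𝒯 (ModuleCat.of A D) :=
    h.torsion_isModuleClass.prod_iff.2 ⟨hθ.mem, (hθ.isExtProjective_coker h).1⟩
  have hfin := finite_extProjSummand (𝒯 := 𝒯) _ (h.torsion_le _ hD)
  -- Each chosen summand divides a power of `D`, hence `D` itself because its endomorphism ring is
  -- local.
  have hfinite : Finite (_root_.Quotient (indecExtProjSetoid 𝒯)) := by
    rw [← Set.finite_univ_iff]
    refine hfin.subset fun q _ => ?_
    have : Module.Finite A (extProjSummand 𝒯 q) :=
      inferInstanceAs (Module.Finite A (FGModuleRepr.repr q.out.1))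
    have := isLocalRing_end_of_indecomposable (M := extProjSummand 𝒯 q) q.out.2.1
    exact (hθ.isSummandOfPower h K q.out.2.2).isDirectSummand
  have : ∀ q, Module.Finite A (extProjSummand 𝒯 q) := fun q =>
    inferInstanceAs (Module.Finite A (FGModuleRepr.repr q.out.1))
  exact inferInstanceAs (Module.Finite A (⨁ q, extProjSummand 𝒯 q))

theorem gen_mono {M T : ModuleCat.{u} A} (h : add M T) : gen T ≤ gen M :=
  fun _ ⟨M₀, f, h₀, hf⟩ => ⟨M₀, f, fun C hC hM => h₀ C hC (h C hC hM), hf⟩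

/-- If `A` has an envelope then `𝒫(𝒯)` generates `𝒯`. -/
theorem IsEnvelope.eq_gen_extProjSum {ℱ : ObjectProperty (ModuleCat.{u} A)} {T : ModuleCat.{u} A}
    {θ : ModuleCat.of A A ⟶ T} (hθ : IsEnvelope 𝒯 θ) (h : IsTorsionPair 𝒯 ℱ) (K : Type w) [Field K]
    [Algebra K A] [FiniteDimensional K A] : 𝒯 = gen (extProjSum 𝒯) := by
  have : IsArtinianRing A := IsArtinianRing.of_finite K A
  have := hθ.finite_extProjSum h K
  refine h.eq_gen h.extProjSum_mem ?_
  have hT := (hθ.isExtProjective h).isSummandOfPower_extProjSum h.torsion_isModuleClass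
    (h.torsion_le _ hθ.mem)
  exact (h.eq_gen_of_isEnvelope hθ).le.trans (gen_mono (add_iff.2 hT))

end ExtProjSum


/-! ### A criterion for projective dimension at most one. -/

section ProjectiveDimension

/-- A module `P` has projective dimension at most one if the ring embeds into a module `T` such that
`Ext¹(P, -)` vanishes on the quotients of the powers of `T`. -/
theorem hasProjectiveDimensionLE_one_of_extVanish {B P T : Type u} [Ring B] [IsNoetherianRing B]
    [AddCommGroup P] [Module B P] [Module.Finite B P] [AddCommGroup T] [Module B T]
    (j : B →ₗ[B] T) (hj : Function.Injective j)
    (hext : ∀ (n : ℕ) (N : Submodule B (Fin n → T)), ExtVanish B P ((Fin n → T) ⧸ N)) :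
    HasProjectiveDimensionLE (ModuleCat.of B P) 1 := by
  obtain ⟨n, π, hπ⟩ := Module.Finite.exists_fin' B P
  obtain ⟨m, ρ, hρ⟩ := Module.Finite.exists_fin' B (LinearMap.ker π)
  let ι : (Fin m → B) →ₗ[B] (Fin m → T) := LinearMap.pi fun i => j ∘ₗ LinearMap.proj i
  have hι : Function.Injective ι := fun x y hxy =>
    funext fun i => hj (congrFun hxy i)
  -- The aim is to split `ρ`. The embedding of `ker π` into `Tᵐ ⧸ N` extends to `Bⁿ` and lifts to `g
  -- : Bⁿ → Tᵐ`. On `ker π`, `g` agrees with `ι` modulo `N = ι(ker ρ)`, so it takes values in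
  -- `ι(Bᵐ)`, and `ι⁻¹ ∘ g` is a section of `ρ`.
  let N := (LinearMap.ker ρ).map ι
  have hN : LinearMap.ker ρ ≤ N.comap ι := Submodule.le_comap_map _ _
  let e := ρ.quotKerEquivOfSurjective hρ
  obtain ⟨G, hG⟩ := (hext m N).exists_extend (LinearMap.ker π).injective_subtype hπ
    (LinearMap.exact_subtype_ker_map π) ((LinearMap.ker ρ).mapQ N ι hN ∘ₗ e.symm.toLinearMap)
  have hGρ : ∀ x, G (ρ x).1 = N.mkQ (ι x) := fun x => by
    have := LinearMap.congr_fun hG (ρ x)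
    rw [LinearMap.comp_apply, LinearMap.comp_apply, LinearEquiv.coe_coe,
      show ρ x = e ((LinearMap.ker ρ).mkQ x) from rfl, LinearEquiv.symm_apply_apply] at this
    exact this
  obtain ⟨g, hg⟩ := Module.projective_lifting_property N.mkQ G N.mkQ_surjective
  have hgρ : ∀ x, ∃ y, ρ y = ρ x ∧ ι y = g (ρ x).1 := fun x => by
    have h₁ : N.mkQ (ι x - g (ρ x).1) = 0 := by
      rw [map_sub, ← hGρ, ← hg, LinearMap.comp_apply, sub_self]
    rw [Submodule.mkQ_apply, Submodule.Quotient.mk_eq_zero] at h₁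
    obtain ⟨y, hy, hy'⟩ := h₁
    exact ⟨x - y, by rw [map_sub, LinearMap.mem_ker.1 hy, sub_zero],
      by rw [map_sub, hy', sub_sub_cancel]⟩
  let s : LinearMap.ker π →ₗ[B] (Fin m → B) := (LinearEquiv.ofInjective ι hι).symm.toLinearMap ∘ₗ
    LinearMap.codRestrict (LinearMap.range ι) (g ∘ₗ (LinearMap.ker π).subtype) fun x => by
      obtain ⟨x, rfl⟩ := hρ x
      obtain ⟨y, -, hy⟩ := hgρ x
      exact ⟨y, hy⟩
  have hιs : ∀ x, ι (s x) = g x.1 := fun x =>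
    congrArg Subtype.val ((LinearEquiv.ofInjective ι hι).apply_symm_apply _)
  have hs : ρ ∘ₗ s = LinearMap.id := LinearMap.ext fun x => by
    obtain ⟨x, rfl⟩ := hρ x
    obtain ⟨y, hy, hy'⟩ := hgρ x
    have : s (ρ x) = y := hι ((hιs _).trans hy'.symm)
    rw [LinearMap.comp_apply, this, hy, LinearMap.id_apply]
  have hproj : Module.Projective B (LinearMap.ker π) := .of_split s ρ hs
  have hS := LinearMap.shortExact_shortComplexKer hπ
  refine (hS.hasProjectiveDimensionLT_X₃_iff 0 ?_).2
    (projective_iff_hasProjectiveDimensionLT_one.1 ?_)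
  · exact (IsProjective.iff_projective (Fin n → B)).1 inferInstance
  · exact (IsProjective.iff_projective (LinearMap.ker π)).1 hproj

end ProjectiveDimension

/-! ### Passage between `A` and `A ⧸ I`. -/

section Quotient

variable {A : Type u} [Ring A] {I : Ideal A} [I.IsTwoSided] {M N : Type u} [AddCommGroup M]
  [Module A M] [Module (A ⧸ I) M] [IsScalarTower A (A ⧸ I) M] [AddCommGroup N]
  [Module A N] [Module (A ⧸ I) N] [IsScalarTower A (A ⧸ I) N]

theorem quotient_mk_smul (a : A) (x : M) : Ideal.Quotient.mk I a • x = a • x := by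
  have : Ideal.Quotient.mk I a = a • (1 : A ⧸ I) := by
    rw [← map_one (Ideal.Quotient.mk I)]
    exact congrArg (Ideal.Quotient.mk I) (mul_one a).symm
  rw [this, smul_assoc, one_smul]

variable (I) in
/-- An `A`-linear map between `A ⧸ I`-modules is `A ⧸ I`-linear. -/
def extendQuotient (f : M →ₗ[A] N) : M →ₗ[A ⧸ I] N where
  toFun := f
  map_add' := map_add f
  map_smul' b x := by
    obtain ⟨a, rfl⟩ := Ideal.Quotient.mk_surjective b
    rw [RingHom.id_apply, quotient_mk_smul, quotient_mk_smul, map_smul]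

theorem isSummandOfPower_quotient_iff :
    IsSummandOfPower (A ⧸ I) M N ↔ IsSummandOfPower A M N := by
  constructor
  · rintro ⟨n, s, r, h⟩
    exact ⟨n, s.restrictScalars A, r.restrictScalars A,
      LinearMap.ext fun x => LinearMap.congr_fun h x⟩
  · rintro ⟨n, s, r, h⟩
    exact ⟨n, extendQuotient I s, extendQuotient I r,
      LinearMap.ext fun x => LinearMap.congr_fun h x⟩

/-- Restriction of scalars is full and keeps short exact sequences exact, so a lift found over `A`
is already a lift over `A ⧸ I`. The converse direction is not available, since extensions over `A`
need not be killed by `I`. -/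
theorem ExtVanish.quotient (h : ExtVanish A M N) : ExtVanish (A ⧸ I) M N := by
  refine .of_lift (A ⧸ I) M N fun E F _ _ _ _ i p hi hp hex f => ?_
  let _ : Module A E := Module.compHom E (Ideal.Quotient.mk I)
  let _ : Module A F := Module.compHom F (Ideal.Quotient.mk I)
  have : IsScalarTower A (A ⧸ I) E := ⟨fun a b x => mul_smul (Ideal.Quotient.mk I a) b x⟩
  have : IsScalarTower A (A ⧸ I) F := ⟨fun a b x => mul_smul (Ideal.Quotient.mk I a) b x⟩
  obtain ⟨g, hg⟩ := h.exists_lift (i := i.restrictScalars A) (p := p.restrictScalars A) hi hp hex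
    (f.restrictScalars A)
  exact ⟨extendQuotient I g, LinearMap.ext fun x => LinearMap.congr_fun hg x⟩

end Quotient

/-! ### Tilting over `A ⧸ ann 𝒯` versus generation of `𝒯`. -/

section Tilting

variable {A : Type u} [Ring A] {𝒯 ℱ : ObjectProperty (ModuleCat.{u} A)} (h : IsTorsionPair 𝒯 ℱ)
  {P : Type u} [AddCommGroup P] [Module A P] [Module (A ⧸ ann 𝒯) P]
  [IsScalarTower A (A ⧸ ann 𝒯) P]

theorem isTorsionBySet_of_mem {X : Type u} [AddCommGroup X] [Module A X]
    (hX : 𝒯 (ModuleCat.of A X)) : Module.IsTorsionBySet A X (ann 𝒯 : Set A) :=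
  fun x a => a.2 _ hX x

include h

theorem isTilting_quotient [IsNoetherianRing A] (hP : IsExtProjective 𝒯 (ModuleCat.of A P))
    {T : ModuleCat.{u} A} {θ : ModuleCat.of A A ⟶ T} (hθ : IsEnvelope 𝒯 θ)
    (hT : IsSummandOfPower A P T) (hT₁ : IsSummandOfPower A P (T ⧸ LinearMap.range θ.hom)) :
    IsTilting (ModuleCat.of (A ⧸ ann 𝒯) P) := by
  let T₁ := T ⧸ LinearMap.range θ.hom
  have hT₁mem : 𝒯 (ModuleCat.of A T₁) := (hθ.isExtProjective_coker h).1
  have htors : Module.IsTorsionBySet A T (ann 𝒯 : Set A) := isTorsionBySet_of_mem hθ.mem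
  have htors₁ : Module.IsTorsionBySet A T₁ (ann 𝒯 : Set A) := isTorsionBySet_of_mem hT₁mem
  let _ : Module (A ⧸ ann 𝒯) T := htors.module
  let _ : Module (A ⧸ ann 𝒯) T₁ := htors₁.module
  have : IsScalarTower A (A ⧸ ann 𝒯) T := htors.isScalarTower
  have : IsScalarTower A (A ⧸ ann 𝒯) T₁ := htors₁.isScalarTower
  have hle : (ann 𝒯 : Submodule A A) ≤ LinearMap.ker θ.hom := fun a ha => by
    rw [LinearMap.mem_ker, ← mul_one a, ← smul_eq_mul, map_smul]
    exact ha _ hθ.mem _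
  let j : (A ⧸ ann 𝒯) →ₗ[A ⧸ ann 𝒯] T :=
    extendQuotient (ann 𝒯) (Submodule.liftQ (ann 𝒯) θ.hom hle)
  have hjmk : ∀ a, j (Ideal.Quotient.mk (ann 𝒯) a) = θ.hom a := fun a => rfl
  have hj : Function.Injective j := by
    rw [injective_iff_map_eq_zero]
    intro b hb
    obtain ⟨a, rfl⟩ := Ideal.Quotient.mk_surjective b
    rw [hjmk] at hb
    exact Ideal.Quotient.eq_zero_iff_mem.2 fun X hX x => hθ.smul_eq_zero hX hb x
  let q : T →ₗ[A ⧸ ann 𝒯] T₁ := extendQuotient (ann 𝒯) (LinearMap.range θ.hom).mkQ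
  have hq : Function.Surjective q := (LinearMap.range θ.hom).mkQ_surjective
  have hex : Function.Exact j q := fun t => by
    change (LinearMap.range θ.hom).mkQ t = 0 ↔ _
    rw [Submodule.mkQ_apply, Submodule.Quotient.mk_eq_zero]
    constructor
    · rintro ⟨a, rfl⟩
      exact ⟨Ideal.Quotient.mk _ a, rfl⟩
    · rintro ⟨b, rfl⟩
      obtain ⟨a, rfl⟩ := Ideal.Quotient.mk_surjective b
      exact ⟨a, rfl⟩
  have : Module.Finite A P := h.finite hP.1
  have hfin : Module.Finite (A ⧸ ann 𝒯) P := .of_restrictScalars_finite A _ P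
  have : IsNoetherianRing (A ⧸ ann 𝒯) :=
    isNoetherian_of_tower A (inferInstanceAs (IsNoetherian A (A ⧸ ann 𝒯)))
  refine ⟨hfin, ExtVanish.quotient (hP.2 _ hP.1), ?_, ?_⟩
  · refine hasProjectiveDimensionLE_one_of_extVanish j hj fun n N => ?_
    refine ExtVanish.quotient (hP.2 _ ?_)
    exact h.of_surjective (h.pi hθ.mem n) (f := N.mkQ.restrictScalars A) N.mkQ_surjective
  · exact ⟨_, shortExact_ofHom hj hq hex, ⟨Iso.refl _⟩,
      add_iff.2 (isSummandOfPower_quotient_iff.2 hT),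
      add_iff.2 (isSummandOfPower_quotient_iff.2 hT₁)⟩

/-- The map `A → A ⧸ ann 𝒯 → T⁰` has kernel `ann 𝒯` and cokernel in `add P`, so `T⁰` generates every
module in `𝒯`. The hypotheses on `P` are conditional because its finiteness is only read off from
the tilting property. -/
theorem IsTilting.eq_gen (hP : IsTilting (ModuleCat.of (A ⧸ ann 𝒯) P))
    (hE : 𝒯 (ModuleCat.of A P) → IsExtProjective 𝒯 (ModuleCat.of A P))
    (hmem : Module.Finite A P → 𝒯 (ModuleCat.of A P)) : 𝒯 = gen (ModuleCat.of A P) := by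
  have hfin : Module.Finite (A ⧸ ann 𝒯) P := hP.finDim
  have hPmem := hmem (Module.Finite.trans (A ⧸ ann 𝒯) P)
  have hPE := hE hPmem
  refine h.eq_gen hPmem fun X hX => ?_
  obtain ⟨S, hS, ⟨e⟩, h₂, h₃⟩ := hP.exists_shortExact
  let _ : Module A S.X₂ := Module.compHom S.X₂ (Ideal.Quotient.mk (ann 𝒯))
  let _ : Module A S.X₃ := Module.compHom S.X₃ (Ideal.Quotient.mk (ann 𝒯))
  have : IsScalarTower A (A ⧸ ann 𝒯) S.X₂ :=
    ⟨fun a b x => mul_smul (Ideal.Quotient.mk (ann 𝒯) a) b x⟩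
  have : IsScalarTower A (A ⧸ ann 𝒯) S.X₃ :=
    ⟨fun a b x => mul_smul (Ideal.Quotient.mk (ann 𝒯) a) b x⟩
  have h₂' : IsSummandOfPower A P S.X₂ := isSummandOfPower_quotient_iff.1 (add_iff.1 h₂)
  have h₃' : IsSummandOfPower A P S.X₃ := isSummandOfPower_quotient_iff.1 (add_iff.1 h₃)
  let j : (A ⧸ ann 𝒯) →ₗ[A ⧸ ann 𝒯] S.X₂ := S.f.hom ∘ₗ e.symm.toLinearEquiv.toLinearMap
  have hj : Function.Injective j :=
    hS.moduleCat_injective_f.comp e.symm.toLinearEquiv.injective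
  let θ : A →ₗ[A] S.X₂ := j.restrictScalars A ∘ₗ Submodule.mkQ (ann 𝒯)
  let p : S.X₂ →ₗ[A] S.X₃ := S.g.hom.restrictScalars A
  have hp : Function.Surjective p := hS.moduleCat_surjective_g
  have hex : Function.Exact S.f.hom S.g.hom :=
    (ShortComplex.ShortExact.moduleCat_exact_iff_function_exact S).1 hS.exact
  have hker : LinearMap.range θ = LinearMap.ker p := by
    ext x
    rw [LinearMap.mem_ker]
    refine Iff.trans ?_ (hex x).symm
    constructor
    · rintro ⟨a, rfl⟩
      exact ⟨_, rfl⟩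
    · rintro ⟨y, rfl⟩
      obtain ⟨a, ha⟩ := Ideal.Quotient.mk_surjective (e.toLinearEquiv y)
      refine ⟨a, ?_⟩
      change S.f.hom (e.symm.toLinearEquiv (Ideal.Quotient.mk (ann 𝒯) a)) = S.f.hom y
      rw [ha]
      exact congrArg S.f.hom (e.toLinearEquiv.symm_apply_apply y)
  have hcok : IsSummandOfPower A P (S.X₂ ⧸ LinearMap.range θ) :=
    h₃'.of_equiv ((Submodule.quotEquivOfEq _ _ hker).trans (p.quotKerEquivOfSurjective hp))
  have hXfin := h.finite hX
  refine gen_mono (add_iff.2 h₂') _ (gen_of_extVanish θ (fun a ha x => ?_)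
    ((hPE.of_isSummandOfPower h.torsion_isModuleClass hcok).2 X hX))
  have : Ideal.Quotient.mk (ann 𝒯) a = 0 := hj (ha.trans (map_zero j).symm)
  exact Ideal.Quotient.eq_zero_iff_mem.1 this X hX x

end Tilting

end TauTilting

/-! ### The equivalence of the four conditions. -/

theorem mainTheorem12 {K : Type w} [Field K] [IsAlgClosed K]
    {A : Type u} [Ring A] [Algebra K A] [FiniteDimensional K A]
    (𝒯 ℱ : ObjectProperty (ModuleCat.{u} A)) (h : TauTilting.IsTorsionPair 𝒯 ℱ) :
    List.TFAE [
      TauTilting.IsFunctoriallyFinite 𝒯,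
      𝒯 = TauTilting.gen (TauTilting.extProjSum 𝒯),
      ∃ X : ModuleCat.{u} A, TauTilting.FinDim A X ∧ 𝒯 = TauTilting.gen X,
      TauTilting.IsTilting (TauTilting.extProjSumQuot 𝒯)] := by
  open TauTilting in
  have : IsArtinianRing A := IsArtinianRing.of_finite K A
  have htors := extProjSum_isTorsionBySet 𝒯
  -- This is the module structure used in `extProjSumQuot`, so the lemmas on tilting apply to it
  -- definitionally.
  let _ : Module (A ⧸ ann 𝒯) (extProjSum 𝒯) := htors.module
  have : IsScalarTower A (A ⧸ ann 𝒯) (extProjSum 𝒯) := htors.isScalarTower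
  have hA : FinDim A (ModuleCat.of A A) := inferInstanceAs (Module.Finite A A)
  tfae_have 1 → 2 := fun ⟨hcov, _⟩ => by
    obtain ⟨T, θ, hθ⟩ := hcov _ hA
    exact hθ.eq_gen_extProjSum h K
  tfae_have 2 → 3 := fun h₂ => by
    -- The direct sum could a priori be infinite; as it belongs to its own `gen`, it lies in `𝒯` and
    -- is finitely generated.
    have hmem : 𝒯 (extProjSum 𝒯) := h₂.ge _ (gen_self _)
    exact ⟨_, h.torsion_le _ hmem, h₂⟩
  tfae_have 3 → 1 := fun ⟨X, hX, hgen⟩ => by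
    have : Module.Finite A X := hX
    exact ⟨h.isCovariantlyFinite_of_eq_gen K X hgen, h.isContravariantlyFinite⟩
  tfae_have 1 → 4 := fun ⟨hcov, _⟩ => by
    obtain ⟨T, θ, hθ⟩ := hcov _ hA
    have := hθ.finite_extProjSum h K
    have hT₁ := hθ.isExtProjective_coker h
    exact isTilting_quotient (P := extProjSum 𝒯) h (isExtProjective_extProjSum h.extProjSum_mem) hθ
      ((hθ.isExtProjective h).isSummandOfPower_extProjSum h.torsion_isModuleClass
        (h.torsion_le _ hθ.mem))
      (hT₁.isSummandOfPower_extProjSum h.torsion_isModuleClass (h.torsion_le _ hT₁.1))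
  tfae_have 4 → 2 := fun h₄ =>
    IsTilting.eq_gen (P := extProjSum 𝒯) h h₄ isExtProjective_extProjSum
      fun _ => h.extProjSum_mem
  tfae_finish
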